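/- Let $F$ be a number field and $\ell$ a prime number. Let $\operatorname{Log}_\ell:\mathbb Q_\ell^\times\to\mathbb Z_\ell$ be the Iwasawa logarithm (with $\operatorname{Log}_\ell\ell=0$). For a finite prime $\mathfrak p$ of $F$ above $p$ put $\tilde f_{\mathfrak p}=[F_{\mathfrak p}\cap\widehat{\mathbb Q}_p^{c}:\mathbb Q_p]$, where $\widehat{\mathbb Q}_p^{c}$ is the cyclotomic $\widehat{\mathbb Z}$-extension of $\mathbb Q_p$ (the compositum of the cyclotomic $\mathbb Z_q$-extensions for all primes $q$), and $\deg_F\mathfrak p=\tilde f_{\mathfrak p}\deg_\ell p$, with $\deg_\ell p=\operatorname{Log}_\ell p$ if $p\neq\ell$, $\deg_\ell\ell=\ell$ if $\ell\ne2$, and $\deg_2 2=4$. The logarithmic valuation of $x\in F_{\mathfrak p}^\times$ is $$\tilde v_{\mathfrak p}(x)=-\frac{\operatorname{Log}_\ell(N_{F_{\mathfrak p}/\mathbb Q_p}(x))}{\deg_F\mathfrak p},$$ where for $\mathfrak p\nmid\ell$ the norm is to be replaced by its $p$-adic absolute value $|N_{F_{\mathfrak p}/\mathbb Q_p}(x)|_p=N\mathfrak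 p^{-v_{\mathfrak p}(x)}$; it extends to the $\ell$-adic compactification $\mathcal R_{\mathfrak p}=\varprojlim_n F_{\mathfrak p}^\times/F_{\mathfrak p}^{\times\ell^n}$. The group of logarithmic divisors $\mathcal D\ell_F$ is the restricted product of the $\mathcal R_{\mathfrak p}$ modulo $\prod_{\mathfrak p}\ker\tilde v_{\mathfrak p}$; via the $\tilde v_{\mathfrak p}$ it is identified with $\bigoplus_{\mathfrak p}\tilde v_{\mathfrak p}(\mathcal R_{\mathfrak p})\,\mathfrak p=\bigoplus_{\mathfrak p}\mathbb Z_\ell\,\mathfrak p$. Put $\deg_F(\sum a_{\mathfrak p}\mathfrak p)=\sum a_{\mathfrak p}\deg_F\mathfrak p$ and let $\widetilde{\mathcal D\ell}_F$ be the subgroup of logarithmic divisors of degree $0$. Let $\widetilde{\mathcal P\ell}_F$ be the group of principal logarithmic divisors, that is, the image of $\mathbb Z_\ell\otimes_{\mathbb Z}F^\times$ under the $\mathbb Z_\ell$-linear map with $1\otimes a\mapsto\sum_{\mathfrak p}\tilde v_{\mathfrak p}(a)\,\mathfrak p$, and put $\widetilde{\mathcal C\ell}_F=\widetilde{\mathcal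 D\ell}_F/\widetilde{\mathcal P\ell}_F$. Let $\mathfrak p_1,\dots,\mathfrak p_s$ be the primes of $F$ above $\ell$, let $\widetilde{\mathcal C\ell}(\ell)\subseteq\widetilde{\mathcal C\ell}_F$ be the subgroup of classes of degree-zero logarithmic divisors of the form $\sum_{i=1}^s a_i\mathfrak p_i$, and let $\mathcal C\ell'$ be the $\ell$-part of $\mathcal C\ell_F/\langle[\mathfrak p_1],\dots,[\mathfrak p_s]\rangle$, where $\mathcal C\ell_F$ is the ideal class group of $F$. Suppose that $\ell^{m'}$ is the exponent of $\mathcal C\ell'$ and that $\widetilde{\mathcal C\ell}(\ell)$ has finite exponent $\ell^{\tilde m}$. Then $$\ell^{m'+\tilde m}\,\mathfrak a\in\widetilde{\mathcal P\ell}_F\qquad\text{for all }\mathfrak a\in\widetilde{\mathcal D\ell}_F .$$ In particular, the exponent of $\widetilde{\mathcal C\ell}_F$ divides $\ell^{m'+\tilde m}$. -/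

import Mathlib

open IsDedekindDomain NumberField HeightOneSpectrum WithZero

namespace LogClass

/-! ### The local fields `F_v` as extensions of `ℚ_p` -/

theorem adicVal_nat_eq_one {F : Type*} [Field F] [NumberField F] 
    (v : HeightOneSpectrum (𝓞 F)) {p : ℕ} (hp : p.Prime)
    (hv : (p : 𝓞 F) ∈ v.asIdeal) {b : ℕ} (hb : ¬ p ∣ b) :
    v.valuation F (b : F) = 1 := by
  have : v.valuation F (algebraMap (𝓞 F) F (b : 𝓞 F)) = 1 := by
    rw [v.valuation_of_algebraMap, v.intValuation_eq_one_iff]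
    intro hbv
    have hc : IsCoprime (p : ℤ) (b : ℤ) :=
      Nat.isCoprime_iff_coprime.2 ((Nat.Prime.coprime_iff_not_dvd hp).2 hb)
    obtain ⟨x, y, hxy⟩ := hc
    apply v.isPrime.ne_top
    rw [Ideal.eq_top_iff_one]
    have : ((x : 𝓞 F) * p + y * b) = 1 := by exact_mod_cast congrArg (Int.cast (R := 𝓞 F)) hxy
    rw [← this]
    exact v.asIdeal.add_mem (v.asIdeal.mul_mem_left _ hv) (v.asIdeal.mul_mem_left _ hbv)
  simpa using this

theorem adicVal_le {F : Type*} [Field F] [NumberField F] 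
    (v : HeightOneSpectrum (𝓞 F)) (p : ℕ) [Fact p.Prime]
    (hv : (p : 𝓞 F) ∈ v.asIdeal) {n : ℕ} {x : ℚ}
    (hx : Rat.padicValuation p x ≤ exp (-n : ℤ)) :
    v.valuation F (x : F) ≤ exp (-n : ℤ) := by
  have hp : p.Prime := Fact.out
  have key : ∀ y : ℚ, Rat.padicValuation p y ≤ 1 → v.valuation F (y : F) ≤ 1 := by
    intro y hy
    rw [Rat.padicValuation_le_one_iff] at hy
    rw [Rat.cast_def, map_div₀, adicVal_nat_eq_one v hp hv hy, div_one]
    simpa using v.valuation_le_one (K := F) (y.num : 𝓞 F)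
  have hpv : v.valuation F (p : F) ≤ exp (-1 : ℤ) := by
    have := (v.intValuation_le_pow_iff_mem (p : 𝓞 F) 1).2 (by simpa using hv)
    rw [← v.valuation_of_algebraMap (K := F)] at this
    simpa using this
  have hp0 : (p : ℚ) ≠ 0 := by exact_mod_cast hp.ne_zero
  have hpF : (p : F) ≠ 0 := by exact_mod_cast hp.ne_zero
  have h1 : Rat.padicValuation p (x / (p : ℚ) ^ n) ≤ 1 := by
    rw [map_div₀, map_pow, Rat.padicValuation_self, ← exp_nsmul]
    rw [div_le_one₀ (by simp)]
    simpa using hx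
  have h2 := key _ h1
  have h3 : (x : F) = ((x / (p : ℚ) ^ n : ℚ) : F) * (p : F) ^ n := by
    push_cast; field_simp
  rw [h3, map_mul, map_pow]
  calc _ ≤ 1 * (exp (-1 : ℤ)) ^ n := mul_le_mul' h2 (pow_le_pow_left' hpv n)
    _ = exp (-n : ℤ) := by rw [one_mul, ← exp_nsmul]; simp

/-- The embedding `ℚ → F → F_v`, with the `p`-adic uniformity on `ℚ`. -/
noncomputable def ratToCompletion {F : Type*} [Field F] [NumberField F] 
    (v : HeightOneSpectrum (𝓞 F)) (p : ℕ) [Fact p.Prime] :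
    WithVal (Rat.padicValuation p) →+* v.adicCompletion F :=
  (FinitePlace.embedding v).comp
    ((algebraMap ℚ F).comp (WithVal.equiv (Rat.padicValuation p)).toRingHom)

theorem uniformContinuous_ratToCompletion {F : Type*} [Field F] [NumberField F] 
    (v : HeightOneSpectrum (𝓞 F)) (p : ℕ) [Fact p.Prime]
    (hv : (p : 𝓞 F) ∈ v.asIdeal) : UniformContinuous (ratToCompletion v p) := by
  have hp : p.Prime := Fact.out
  apply uniformContinuous_of_continuousAt_zero
  rw [ContinuousAt, map_zero, Padic.isUniformInducing_cast_withVal.isInducing.nhds_eq_comap,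
    map_zero, Metric.nhds_basis_closedBall.tendsto_right_iff]
  intro ε hε
  have hN : 1 < ((Ideal.absNorm v.asIdeal : ℕ) : ℝ) := by
    exact_mod_cast NumberField.HeightOneSpectrum.one_lt_absNorm v
  obtain ⟨n, hn⟩ := exists_pow_lt_of_lt_one hε (inv_lt_one_of_one_lt₀ hN)
  have hpn : (0 : ℝ) < (p : ℝ) ^ (-n : ℤ) := zpow_pos (by exact_mod_cast hp.pos) _
  refine Filter.mem_comap.2 ⟨Metric.closedBall 0 _, Metric.closedBall_mem_nhds _ hpn, ?_⟩
  intro x hx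
  set y : ℚ := WithVal.equiv (Rat.padicValuation p) x with hy
  have hx' : ‖((y : ℚ) : ℚ_[p])‖ ≤ (p : ℝ) ^ (-n : ℤ) := by
    have h := mem_closedBall_zero_iff.1 hx
    exact h
  have h1 : Rat.padicValuation p y ≤ exp (-n : ℤ) := by
    by_cases h0 : y = 0
    · simp [h0]
    · rw [Padic.eq_padicNorm, padicNorm.eq_zpow_of_nonzero h0] at hx'
      push_cast at hx'
      rw [zpow_le_zpow_iff_right₀ (by exact_mod_cast hp.one_lt)] at hx'
      rw [show Rat.padicValuation p y = exp (-padicValRat p y) by simp [Rat.padicValuation, h0],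
        exp_le_exp]
      exact hx'
  have h2 := adicVal_le v p hv h1
  have h3 : ratToCompletion v p x = FinitePlace.embedding v (y : F) := by
    simp [ratToCompletion, hy]
  show ratToCompletion v p x ∈ Metric.closedBall 0 ε
  rw [mem_closedBall_zero_iff, h3, FinitePlace.norm_embedding']
  refine le_trans ?_ hn.le
  have h4 := (WithZeroMulInt.toNNReal_strictMono
    (NumberField.HeightOneSpectrum.one_lt_absNorm_nnreal v)).monotone h2
  have h5 : WithZeroMulInt.toNNReal (NumberField.HeightOneSpectrum.absNorm_ne_zero v)
      (exp (-n : ℤ)) = ((Ideal.absNorm v.asIdeal : NNReal)⁻¹) ^ n := by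
    rw [WithZeroMulInt.toNNReal_neg_apply _ (by simp)]
    rw [← zpow_natCast, inv_zpow', NNReal.coe_inj.symm]
    rfl
  rw [h5] at h4
  exact_mod_cast h4

/-- The canonical embedding `ℚ_p → F_v` for a prime `v` of `F` above `p`: the continuous extension
of `ℚ → F_v`. -/
noncomputable def padicToCompletion {F : Type*} [Field F] [NumberField F] 
    (v : HeightOneSpectrum (𝓞 F)) (p : ℕ) [Fact p.Prime]
    (hv : (p : 𝓞 F) ∈ v.asIdeal) : ℚ_[p] →+* v.adicCompletion F :=
  IsDenseInducing.extendRingHom Padic.isUniformInducing_cast_withVal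
    Padic.isDenseInducing_cast_withVal.dense (uniformContinuous_ratToCompletion v p hv)

/-- `F_v` as an algebra over `ℚ_p`, for `v` above `p`. -/
@[reducible]
noncomputable def completionAlgebra {F : Type*} [Field F] [NumberField F]
    (v : HeightOneSpectrum (𝓞 F)) (p : ℕ) [Fact p.Prime]
    (hv : (p : 𝓞 F) ∈ v.asIdeal) : Algebra ℚ_[p] (v.adicCompletion F) :=
  (padicToCompletion v p hv).toAlgebra

/-- The local norm `N_{F_v / ℚ_p}`, for `v` above `p`. -/
noncomputable def localNorm {F : Type*} [Field F] [NumberField F]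
    (v : HeightOneSpectrum (𝓞 F)) (p : ℕ) [Fact p.Prime]
    (hv : (p : 𝓞 F) ∈ v.asIdeal) (x : v.adicCompletion F) : ℚ_[p] :=
  letI := completionAlgebra v p hv
  Algebra.norm ℚ_[p] x

/-- The rational prime below `v`. -/
noncomputable def residueChar {F : Type*} [Field F] [NumberField F]
    (v : HeightOneSpectrum (𝓞 F)) : ℕ :=
  ringChar (𝓞 F ⧸ v.asIdeal)

theorem residueChar_prime {F : Type*} [Field F] [NumberField F]
    (v : HeightOneSpectrum (𝓞 F)) : (residueChar v).Prime := by
  have : Finite (𝓞 F ⧸ v.asIdeal) := v.asIdeal.finiteQuotientOfFreeOfNeBot v.ne_bot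
  have := v.isPrime
  exact (CharP.char_is_prime_or_zero (𝓞 F ⧸ v.asIdeal) (ringChar (𝓞 F ⧸ v.asIdeal))).resolve_right
    (CharP.ringChar_ne_zero_of_finite _)

theorem residueChar_mem {F : Type*} [Field F] [NumberField F]
    (v : HeightOneSpectrum (𝓞 F)) : (residueChar v : 𝓞 F) ∈ v.asIdeal := by
  rw [← Ideal.Quotient.eq_zero_iff_mem, map_natCast]
  exact ringChar.Nat.cast_ringChar

/-! ### Cyclotomic extensions and the logarithmic inertia degree -/

/-- The cyclotomic `ℤ_q`-extension of `k` inside the extension field `Ω`: the subfield of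
`E = k(μ_{q^∞})` fixed by the torsion subgroup of the abelian group `Gal(E/k)`. -/
noncomputable def cyclotomicZq (k Ω : Type*) [Field k] [Field Ω] [Algebra k Ω] (q : ℕ) :
    IntermediateField k Ω :=
  let E : IntermediateField k Ω := IntermediateField.adjoin k {ζ : Ω | ∃ n : ℕ, ζ ^ q ^ n = 1}
  IntermediateField.lift
    (IntermediateField.fixedField (Subgroup.closure {σ : E ≃ₐ[k] E | IsOfFinOrder σ}))

/-- The cyclotomic `Ẑ`-extension of `k` inside `Ω`: the compositum of the cyclotomic
`ℤ_q`-extensions over all primes `q`. -/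
noncomputable def cyclotomicZHat (k Ω : Type*) [Field k] [Field Ω] [Algebra k Ω] :
    IntermediateField k Ω :=
  ⨆ q : Nat.Primes, cyclotomicZq k Ω q

/-- The degree `[K ∩ k^c : k]`, where `k^c` is the cyclotomic `Ẑ`-extension of `k`, both fields
being taken inside an algebraic closure of `K`. -/
noncomputable def cyclotomicDegree (k K : Type*) [Field k] [Field K] [Algebra k K] : ℕ :=
  Module.finrank k
    ↥(cyclotomicZHat k (AlgebraicClosure K) ⊓
      (IsScalarTower.toAlgHom k K (AlgebraicClosure K)).fieldRange)

/-- The absolute logarithmic inertia degree `f̃_v = [F_v ∩ ℚ_p^c : ℚ_p]`, `p` the prime below `v`. -/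
noncomputable def logInertiaDeg {F : Type*} [Field F] [NumberField F]
    (v : HeightOneSpectrum (𝓞 F)) : ℕ :=
  haveI : Fact (residueChar v).Prime := ⟨residueChar_prime v⟩
  letI := completionAlgebra v (residueChar v) (residueChar_mem v)
  cyclotomicDegree ℚ_[residueChar v] (v.adicCompletion F)

/-! ### The Iwasawa logarithm, `ℓ`-adic degrees and logarithmic valuations -/

/-- The Iwasawa logarithm `Log_ℓ : ℚ_ℓˣ → ℚ_ℓ` with `Log_ℓ ℓ = 0`. If `x = ℓ^a u` with `u` a unit
then `y = u^(ℓ-1)` lies in `1 + ℓ ℤ_ℓ` and `Log_ℓ x = (ℓ-1)⁻¹ log y`, where `log y` is the usual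
power series in `y - 1`. -/
noncomputable def iwasawaLog (ℓ : ℕ) [Fact ℓ.Prime] (x : ℚ_[ℓ]) : ℚ_[ℓ] :=
  let y : ℚ_[ℓ] := (x * (ℓ : ℚ_[ℓ]) ^ (-x.valuation)) ^ (ℓ - 1)
  ((ℓ : ℚ_[ℓ]) - 1)⁻¹ * ∑' n : ℕ, (-1) ^ n * (y - 1) ^ (n + 1) / ((n : ℚ_[ℓ]) + 1)

/-- The `ℓ`-adic degree `deg_ℓ p` of a rational prime `p`. -/
noncomputable def degPrime (ℓ : ℕ) [Fact ℓ.Prime] (p : ℕ) : ℚ_[ℓ] :=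
  if p = ℓ then (if ℓ = 2 then 4 else (ℓ : ℚ_[ℓ])) else iwasawaLog ℓ (p : ℚ_[ℓ])

/-- The `ℓ`-adic degree `deg_F v = f̃_v deg_ℓ p` of a prime `v` of `F` above `p`. -/
noncomputable def deg (ℓ : ℕ) [Fact ℓ.Prime] {F : Type*} [Field F] [NumberField F]
    (v : HeightOneSpectrum (𝓞 F)) : ℚ_[ℓ] :=
  (logInertiaDeg v : ℚ_[ℓ]) * degPrime ℓ (residueChar v)

open Classical in
/-- The logarithmic valuation `ṽ_v(x) = - Log_ℓ (N_{F_v/ℚ_p} x) / deg_F v` on `F_vˣ`.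
For `v ∤ ℓ` the norm is an element of `ℚ_p` with `p ≠ ℓ`, and `Log_ℓ` of it means `Log_ℓ` of its
`p`-adic absolute value `|N_{F_v/ℚ_p} x|_p = (N v)^(-ord_v x)`, a positive rational number; here
`Valued.v x = exp (-ord_v x)`. Thus `ṽ_v = (f_v / f̃_v) ord_v` for these `v`. -/
noncomputable def logVal (ℓ : ℕ) [Fact ℓ.Prime] {F : Type*} [Field F] [NumberField F]
    (v : HeightOneSpectrum (𝓞 F)) (x : v.adicCompletion F) : ℚ_[ℓ] :=
  if h : (ℓ : 𝓞 F) ∈ v.asIdeal then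
    -iwasawaLog ℓ (localNorm v ℓ h x) / deg ℓ v
  else
    -iwasawaLog ℓ ((Ideal.absNorm v.asIdeal : ℚ_[ℓ]) ^ (WithZero.log (Valued.v x))) / deg ℓ v

/-! ### Logarithmic divisors and classes -/

/-- The image `ṽ_v(R_v)` of the `ℓ`-adic compactification `R_v` of `F_vˣ` under the logarithmic
valuation. As `R_v` is generated as a `ℤ_ℓ`-module by `F_vˣ`, this is the `ℤ_ℓ`-span of
`ṽ_v(F_vˣ)`. It is isomorphic to `R_v` modulo its logarithmic units `ker ṽ_v`. -/
noncomputable def logValueModule (ℓ : ℕ) [Fact ℓ.Prime] {F : Type*} [Field F] [NumberField F]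
    (v : HeightOneSpectrum (𝓞 F)) : Submodule ℤ_[ℓ] ℚ_[ℓ] :=
  Submodule.span ℤ_[ℓ] (Set.range fun x : (v.adicCompletion F)ˣ => logVal ℓ v (x : v.adicCompletion F))

/-- Finitely supported families of elements of `ℚ_ℓ` indexed by the primes of `F`. -/
abbrev RatDiv (ℓ : ℕ) [Fact ℓ.Prime] (F : Type*) [Field F] [NumberField F] : Type _ :=
  DirectSum (HeightOneSpectrum (𝓞 F)) fun _ => ℚ_[ℓ]

/-- The group `Dℓ_F` of logarithmic divisors: the quotient of the `ℓ`-adified idele group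
`∏^res R_v` by the idelic logarithmic units `∏ ker ṽ_v`, identified through the logarithmic
valuations with `⨁_v ṽ_v(R_v)`. A divisor `D = ∑ a_v v` has the coefficients `a_v = D v`. -/
noncomputable def logDiv (ℓ : ℕ) [Fact ℓ.Prime] (F : Type*) [Field F] [NumberField F] :
    Submodule ℤ_[ℓ] (RatDiv ℓ F) where
  carrier := {D | ∀ v, D v ∈ logValueModule ℓ v}
  add_mem' h₁ h₂ v := (logValueModule ℓ v).add_mem (h₁ v) (h₂ v)
  zero_mem' v := (logValueModule ℓ v).zero_mem
  smul_mem' c _ h v := (logValueModule ℓ v).smul_mem c (h v)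

open Classical in
/-- The degree `∑ a_v v ↦ ∑ a_v deg_F v`. -/
noncomputable def divDeg (ℓ : ℕ) [Fact ℓ.Prime] (F : Type*) [Field F] [NumberField F] :
    RatDiv ℓ F →ₗ[ℤ_[ℓ]] ℚ_[ℓ] :=
  DirectSum.toModule ℤ_[ℓ] (HeightOneSpectrum (𝓞 F)) ℚ_[ℓ]
    (fun v => LinearMap.mulRight ℤ_[ℓ] (deg ℓ v))

/-- The group `D̃ℓ_F` of logarithmic divisors of degree zero. -/
noncomputable def logDivZero (ℓ : ℕ) [Fact ℓ.Prime] (F : Type*) [Field F] [NumberField F] :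
    Submodule ℤ_[ℓ] (RatDiv ℓ F) :=
  logDiv ℓ F ⊓ LinearMap.ker (divDeg ℓ F)

/-- The group `P̃ℓ_F` of principal logarithmic divisors: the image of `R_F = ℤ_ℓ ⊗ Fˣ` under the
`ℤ_ℓ`-linear map with `1 ⊗ a ↦ div a = ∑ ṽ_v(a) v`, that is, the `ℤ_ℓ`-span of the divisors
`div a`, `a ∈ Fˣ`. -/
noncomputable def logPrincipal (ℓ : ℕ) [Fact ℓ.Prime] (F : Type*) [Field F] [NumberField F] :
    Submodule ℤ_[ℓ] (RatDiv ℓ F) :=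
  Submodule.span ℤ_[ℓ] {D | ∃ a : Fˣ, ∀ v : HeightOneSpectrum (𝓞 F),
    D v = logVal ℓ v (FinitePlace.embedding v (a : F))}

/-- The logarithmic class group `C̃ℓ_F = D̃ℓ_F / P̃ℓ_F`. -/
abbrev LogClassGroup (ℓ : ℕ) [Fact ℓ.Prime] (F : Type*) [Field F] [NumberField F] : Type _ :=
  ↥(logDivZero ℓ F) ⧸ (logPrincipal ℓ F).submoduleOf (logDivZero ℓ F)

/-- The group of degree-zero logarithmic divisors supported on the primes above `ℓ`. -/
noncomputable def logDivZeroAbove (ℓ : ℕ) [Fact ℓ.Prime] (F : Type*) [Field F] [NumberField F] :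
    Submodule ℤ_[ℓ] ↥(logDivZero ℓ F) where
  carrier := {D | ∀ v : HeightOneSpectrum (𝓞 F), (ℓ : 𝓞 F) ∉ v.asIdeal → D.1 v = 0}
  add_mem' h₁ h₂ v hv := by
    simpa [h₁ v hv] using h₂ v hv
  zero_mem' _ _ := rfl
  smul_mem' c D h v hv := by
    have := h v hv
    simp [DirectSum.smul_apply, this]

/-- The subgroup `C̃ℓ(ℓ)` of `C̃ℓ_F`: classes of degree-zero logarithmic divisors supported on the
primes above `ℓ`. -/
noncomputable def logClassAbove (ℓ : ℕ) [Fact ℓ.Prime] (F : Type*) [Field F] [NumberField F] :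
    Submodule ℤ_[ℓ] (LogClassGroup ℓ F) :=
  (logDivZeroAbove ℓ F).map ((logPrincipal ℓ F).submoduleOf (logDivZero ℓ F)).mkQ

/-- The subgroup `⟨[𝔭₁], …, [𝔭ₛ]⟩` of the class group generated by the primes above `ℓ`. -/
noncomputable def primesAbove (ℓ : ℕ) (F : Type*) [Field F] [NumberField F] :
    Subgroup (ClassGroup (𝓞 F)) :=
  Subgroup.closure {c | ∃ v : HeightOneSpectrum (𝓞 F), (ℓ : 𝓞 F) ∈ v.asIdeal ∧
    c = ClassGroup.mk0 ⟨v.asIdeal, mem_nonZeroDivisors_of_ne_zero v.ne_bot⟩}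

/-- The group `Cℓ'` of `ℓ`-ideal classes: the `ℓ`-part of `Cℓ_F / ⟨[𝔭₁], …, [𝔭ₛ]⟩`. -/
noncomputable def ellIdealClasses (ℓ : ℕ) [Fact ℓ.Prime] (F : Type*) [Field F] [NumberField F] :
    Subgroup (ClassGroup (𝓞 F) ⧸ primesAbove ℓ F) :=
  CommGroup.primaryComponent (ClassGroup (𝓞 F) ⧸ primesAbove ℓ F) ℓ

end LogClass

namespace LogClass

/-! ### The `p`-adic logarithm -/

section PadicLog

open Filter Topology

variable {p : ℕ} [Fact p.Prime]

/-! Away from `ℓ` the logarithmic valuation is a constant multiple of `ord_v`, so there logarithmic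
divisors behave like ordinary ideals with `ℤ_ℓ`-coefficients. Write the order of `Cl_F / ⟨primes
above ℓ⟩` as `h` times a power of `ℓ`, with `h` prime to `ℓ`. For `v ∤ ℓ`, the ideal `v ^ (h ℓ^m')`
becomes principal after multiplication by an ideal supported above `ℓ`. Its generator has a
logarithmic divisor which, outside `ℓ`, lives only at `v`. Since `h` is a unit of `ℤ_ℓ`, it can be
divided out, and summing over `v` gives a principal divisor `E` agreeing with `ℓ^m' D` outside `ℓ`
(`exists_principal_eq_away`).

If `D` has degree zero, then so does `ℓ^m' D - E`, because principal divisors have degree zero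
(`logPrincipal_le_logDivZero`). This difference is supported above `ℓ`, so its class is killed by
`ℓ^mt`; as `ℓ^mt E` is principal, so is `ℓ^(m'+mt) D`.

Degree zero for principal divisors is a product formula and takes most of the work. It needs the
Iwasawa logarithm to be a homomorphism killing `ℓ` and `-1` (`iwasawaLog_mul`), and the global norm
to be the product of the local norms above `ℓ` (`prod_localNorm`). Then the places above `ℓ`
contribute `-Log N(a)`, and the others contribute `Log |N(a)|` by the usual product formula. -/

theorem norm_natCast_inv_le (n : ℕ) : ‖((n : ℚ_[p]))⁻¹‖ ≤ n := by
  rcases Nat.eq_zero_or_pos n with rfl | hn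
  · simp
  have hp : p.Prime := Fact.out
  rw [norm_inv, Padic.norm_eq_zpow_neg_valuation (by exact_mod_cast hn.ne'), Padic.valuation_natCast,
    zpow_neg, inv_inv, zpow_natCast]
  exact_mod_cast Nat.le_of_dvd hn pow_padicValNat_dvd

theorem tendsto_prime_pow_zero : Tendsto (fun n : ℕ => ((p : ℚ_[p])) ^ n) atTop (𝓝 0) :=
  tendsto_pow_atTop_nhds_zero_of_norm_lt_one Padic.norm_p_lt_one

/-- Since `p^n → 0`, the polynomial `choose x k` at `x = p^n - 1` tends to its value at `-1`, which
is `(-1)^k`. These are the signs in the logarithm series. -/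
theorem tendsto_choose_prime_pow_pred (k : ℕ) :
    Tendsto (fun n : ℕ => (((p ^ n - 1).choose k : ℕ) : ℚ_[p])) atTop (𝓝 ((-1) ^ k)) := by
  have hp : p.Prime := Fact.out
  induction k with
  | zero => simp
  | succ k ih =>
    -- Pascal's rule combined with `(m + 1) choose(m, k) = (k + 1) choose(m + 1, k + 1)` for `m + 1
    -- = p^n`.
    have h1 : ∀ n : ℕ, (((p ^ n - 1).choose (k + 1) : ℕ) : ℚ_[p]) =
        (p : ℚ_[p]) ^ n * (((p ^ n - 1).choose k : ℕ) : ℚ_[p]) * ((k : ℚ_[p]) + 1)⁻¹ -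
          (((p ^ n - 1).choose k : ℕ) : ℚ_[p]) := by
      intro n
      obtain ⟨m, hm⟩ := Nat.exists_eq_add_of_lt (pow_pos hp.pos n)
      have hm' : p ^ n = m + 1 := by omega
      have e1 := Nat.add_one_mul_choose_eq m k
      have e2 := Nat.choose_succ_succ m k
      have hk : ((k : ℚ_[p]) + 1) ≠ 0 := by exact_mod_cast Nat.succ_ne_zero k
      have hpn : (p : ℚ_[p]) ^ n = (m : ℚ_[p]) + 1 := by exact_mod_cast congrArg (Nat.cast (R := ℚ_[p])) hm'
      rw [hm', hpn, Nat.add_sub_cancel, eq_sub_iff_add_eq, eq_mul_inv_iff_mul_eq₀ hk]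
      rw [e2] at e1
      have e3 := congrArg (Nat.cast (R := ℚ_[p])) e1
      push_cast at e3
      rw [e3]; ring
    simp_rw [h1]
    have := ((tendsto_prime_pow_zero (p := p)).mul ih).mul_const (((k : ℚ_[p]) + 1)⁻¹)
    have := this.sub ih
    convert this using 2
    ring

/-- The power series of the logarithm at `y`, in powers of `y - 1`. -/
noncomputable def logSeries (y : ℚ_[p]) : ℚ_[p] :=
  ∑' n : ℕ, (-1) ^ n * (y - 1) ^ (n + 1) / ((n : ℚ_[p]) + 1)

/-- Binomial expansion of `((y - 1) + 1)^(N + 1)`, with `choose(N + 1, k + 1) / (N + 1) = choose(N,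
k) / (k + 1)`. The finite sum is written as a `tsum` so that a limit can be taken termwise. -/
theorem pow_sub_one_div_eq (y : ℚ_[p]) (N : ℕ) :
    (y ^ (N + 1) - 1) / ((N : ℚ_[p]) + 1) =
      ∑' k : ℕ, (N.choose k : ℚ_[p]) * ((y - 1) ^ (k + 1) / ((k : ℚ_[p]) + 1)) := by
  have hN : ((N : ℚ_[p]) + 1) ≠ 0 := by exact_mod_cast Nat.succ_ne_zero N
  rw [tsum_eq_sum (s := Finset.range (N + 1))]
  · rw [div_eq_iff hN, Finset.sum_mul]
    have hy : y = (y - 1) + 1 := by ring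
    conv_lhs => rw [hy, add_pow, Finset.sum_range_succ']
    simp only [one_pow, mul_one, pow_zero, Nat.choose_zero_right, Nat.cast_one,
      add_sub_cancel_right]
    refine Finset.sum_congr rfl fun k _ => ?_
    have hk : ((k : ℚ_[p]) + 1) ≠ 0 := by exact_mod_cast Nat.succ_ne_zero k
    have e3 := congrArg (Nat.cast (R := ℚ_[p])) (Nat.add_one_mul_choose_eq N k)
    push_cast at e3
    field_simp
    linear_combination -(y - 1) ^ (k + 1) * e3
  · intro k hk
    rw [Nat.choose_eq_zero_of_lt (by simpa using hk)]
    simp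

/-- Describes the logarithm as the derivative of `s ↦ y^s` at `0`, along `s = p^n`; additivity is
then visible without manipulating series. Dominated convergence applies because binomial
coefficients have norm at most `1` and `‖1/(k+1)‖ ≤ k + 1`. -/
theorem tendsto_pow_sub_one_div {y : ℚ_[p]} (hy : ‖y - 1‖ < 1) :
    Tendsto (fun n : ℕ => (y ^ p ^ n - 1) / (p : ℚ_[p]) ^ n) atTop (𝓝 (logSeries y)) := by
  have hp : p.Prime := Fact.out
  have h1 : ∀ n : ℕ, (y ^ p ^ n - 1) / (p : ℚ_[p]) ^ n =
      ∑' k : ℕ, ((p ^ n - 1).choose k : ℚ_[p]) * ((y - 1) ^ (k + 1) / ((k : ℚ_[p]) + 1)) := by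
    intro n
    rw [← pow_sub_one_div_eq]
    have : p ^ n - 1 + 1 = p ^ n := Nat.sub_add_cancel (pow_pos hp.pos n)
    have h2 := congrArg (Nat.cast (R := ℚ_[p])) this
    push_cast at h2
    rw [this, h2]
  simp_rw [h1, logSeries, mul_div_assoc]
  refine tendsto_tsum_of_dominated_convergence
    (bound := fun k : ℕ => ((k + 1 : ℕ) : ℝ) ^ 1 * ‖y - 1‖ ^ (k + 1)) ?_ ?_ ?_
  · exact (summable_nat_add_iff (f := fun k : ℕ => (k : ℝ) ^ 1 * ‖y - 1‖ ^ k) 1).2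
      (summable_pow_mul_geometric_of_norm_lt_one 1 (by simpa using hy))
  · intro k
    exact (tendsto_choose_prime_pow_pred k).mul_const _
  · refine Eventually.of_forall fun n k => ?_
    rw [norm_mul, div_eq_mul_inv, norm_mul, norm_pow, pow_one]
    have e1 : ‖(((p ^ n - 1).choose k : ℕ) : ℚ_[p])‖ ≤ 1 := by
      simpa using Padic.norm_int_le_one (p := p) ((p ^ n - 1).choose k : ℤ)
    have e2 := norm_natCast_inv_le (p := p) (k + 1)
    push_cast at e2 ⊢
    calc _ ≤ 1 * (‖y - 1‖ ^ (k + 1) * ((k : ℝ) + 1)) := by gcongr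
      _ = _ := by ring

theorem logSeries_mul {x y : ℚ_[p]} (hx : ‖x - 1‖ < 1) (hy : ‖y - 1‖ < 1) :
    logSeries (x * y) = logSeries x + logSeries y := by
  have hp : p.Prime := Fact.out
  have hxy : ‖x * y - 1‖ < 1 := by
    have e : x * y - 1 = (x - 1) * (y - 1) + ((x - 1) + (y - 1)) := by ring
    rw [e]
    refine lt_of_le_of_lt (IsUltrametricDist.norm_add_le_max _ _) (max_lt ?_
      (lt_of_le_of_lt (IsUltrametricDist.norm_add_le_max _ _) (max_lt hx hy)))
    rw [norm_mul]
    exact mul_lt_one_of_nonneg_of_lt_one_left (norm_nonneg _) hx hy.le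
  have tx := tendsto_pow_sub_one_div hx
  have ty := tendsto_pow_sub_one_div hy
  -- From `XY - 1 = (X - 1) + (Y - 1) + (X - 1)(Y - 1)` with `X = x^(p^n)`, `Y = y^(p^n)`: after
  -- division by `p^n` the last term keeps a factor `p^n` and disappears in the limit.
  have t := (tx.add ty).add ((tx.mul ty).mul (tendsto_prime_pow_zero (p := p)))
  rw [mul_zero, add_zero] at t
  refine tendsto_nhds_unique (tendsto_pow_sub_one_div hxy) (t.congr fun n => ?_)
  have : (p : ℚ_[p]) ^ n ≠ 0 := pow_ne_zero _ (by exact_mod_cast hp.ne_zero)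
  field_simp
  ring

/-- Fermat's little theorem in the residue field `ℤ/p`; it places the argument of the series in its
disc of convergence. -/
theorem norm_pow_pred_sub_one_lt {u : ℚ_[p]} (hu : ‖u‖ = 1) : ‖u ^ (p - 1) - 1‖ < 1 := by
  set w : ℤ_[p] := ⟨u, hu.le⟩ with hw
  have h0 : PadicInt.toZMod w ≠ 0 := by
    intro h
    have h1 : w ∈ RingHom.ker (PadicInt.toZMod (p := p)) := h
    rw [PadicInt.ker_toZMod, PadicInt.maximalIdeal_eq_span_p, Ideal.mem_span_singleton,
      ← PadicInt.norm_lt_one_iff_dvd] at h1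
    exact absurd hu h1.ne
  have h1 : w ^ (p - 1) - 1 ∈ RingHom.ker (PadicInt.toZMod (p := p)) := by
    rw [RingHom.mem_ker, map_sub, map_pow, ZMod.pow_card_sub_one_eq_one h0, map_one, sub_self]
  rw [PadicInt.ker_toZMod, PadicInt.maximalIdeal_eq_span_p, Ideal.mem_span_singleton,
      ← PadicInt.norm_lt_one_iff_dvd] at h1
  rw [PadicInt.norm_def, PadicInt.coe_sub, PadicInt.coe_pow, PadicInt.coe_one] at h1
  exact h1

theorem norm_unitPart {x : ℚ_[p]} (hx : x ≠ 0) : ‖x * (p : ℚ_[p]) ^ (-x.valuation)‖ = 1 := by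
  have hp : p.Prime := Fact.out
  have hp0 : (p : ℝ) ≠ 0 := by exact_mod_cast hp.ne_zero
  rw [norm_mul, Padic.norm_eq_zpow_neg_valuation hx, Padic.norm_p_zpow, ← zpow_add₀ hp0]
  simp

theorem iwasawaLog_eq (x : ℚ_[p]) : iwasawaLog p x = ((p : ℚ_[p]) - 1)⁻¹ *
    logSeries ((x * (p : ℚ_[p]) ^ (-x.valuation)) ^ (p - 1)) := rfl

theorem iwasawaLog_mul {x y : ℚ_[p]} (hx : x ≠ 0) (hy : y ≠ 0) :
    iwasawaLog p (x * y) = iwasawaLog p x + iwasawaLog p y := by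
  have hp0 : (p : ℚ_[p]) ≠ 0 := by exact_mod_cast (Fact.out : p.Prime).ne_zero
  rw [iwasawaLog_eq, iwasawaLog_eq, iwasawaLog_eq, ← mul_add,
    ← logSeries_mul (norm_pow_pred_sub_one_lt (norm_unitPart hx))
      (norm_pow_pred_sub_one_lt (norm_unitPart hy)), Padic.valuation_mul hx hy, neg_add,
    zpow_add₀ hp0, ← mul_pow]
  congr 3
  ring

variable (p) in
/-- The Iwasawa logarithm as a homomorphism on `ℚ_pˣ`. -/
noncomputable def iwasawaLogHom : ℚ_[p]ˣ →* Multiplicative ℚ_[p] :=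
  MonoidHom.mk' (fun x => Multiplicative.ofAdd (iwasawaLog p x)) fun x y => by
    rw [Units.val_mul, iwasawaLog_mul x.ne_zero y.ne_zero, ofAdd_add]

theorem iwasawaLog_one : iwasawaLog p 1 = 0 := by
  simpa using iwasawaLog_mul (p := p) one_ne_zero one_ne_zero

theorem iwasawaLog_zpow {x : ℚ_[p]} (hx : x ≠ 0) (n : ℤ) :
    iwasawaLog p (x ^ n) = n * iwasawaLog p x := by
  have := congrArg Multiplicative.toAdd (map_zpow (iwasawaLogHom p) (Units.mk0 x hx) n)
  simpa [iwasawaLogHom] using this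

theorem iwasawaLog_prod {ι : Type*} (s : Finset ι) (f : ι → ℚ_[p]) (hf : ∀ i ∈ s, f i ≠ 0) :
    iwasawaLog p (∏ i ∈ s, f i) = ∑ i ∈ s, iwasawaLog p (f i) := by
  classical
  induction s using Finset.induction_on with
  | empty => simpa using iwasawaLog_one
  | insert a s ha ih =>
    rw [Finset.prod_insert ha, Finset.sum_insert ha, iwasawaLog_mul (hf a (by simp))
      (Finset.prod_ne_zero_iff.2 fun i hi => hf i (by simp [hi])), ih fun i hi => hf i (by simp [hi])]

theorem iwasawaLog_neg_one : iwasawaLog p (-1) = 0 := by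
  have h := iwasawaLog_mul (p := p) (x := -1) (y := -1) (by simp) (by simp)
  rw [neg_mul_neg, mul_one, iwasawaLog_one] at h
  exact self_eq_neg.1 (eq_neg_of_add_eq_zero_left h.symm)

theorem iwasawaLog_neg {x : ℚ_[p]} (hx : x ≠ 0) : iwasawaLog p (-x) = iwasawaLog p x := by
  rw [← neg_one_mul, iwasawaLog_mul (by simp) hx, iwasawaLog_neg_one, zero_add]

theorem iwasawaLog_self : iwasawaLog p (p : ℚ_[p]) = 0 := by
  have hp0 : (p : ℚ_[p]) ≠ 0 := by exact_mod_cast (Fact.out : p.Prime).ne_zero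
  rw [iwasawaLog_eq, Padic.valuation_p]
  simp [logSeries, hp0]

end PadicLog

/-! ### `ℚ_p ⊗ F` and the completions above `p` -/

section LocalGlobal

open Filter Topology

variable {F : Type*} [Field F] [NumberField F]

theorem residueChar_eq {v : HeightOneSpectrum (𝓞 F)} {p : ℕ} (hp : p.Prime)
    (hv : (p : 𝓞 F) ∈ v.asIdeal) : residueChar v = p := by
  have h : (p : 𝓞 F ⧸ v.asIdeal) = 0 := by
    rw [← map_natCast (Ideal.Quotient.mk v.asIdeal), Ideal.Quotient.eq_zero_iff_mem]
    exact hv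
  exact (Nat.prime_dvd_prime_iff_eq (residueChar_prime v) hp).1 (ringChar.dvd h)

variable (v : HeightOneSpectrum (𝓞 F)) (p : ℕ) [Fact p.Prime] (hv : (p : 𝓞 F) ∈ v.asIdeal)

theorem continuous_padicToCompletion : Continuous (padicToCompletion v p hv) :=
  (uniformContinuous_uniformly_extend Padic.isUniformInducing_cast_withVal
    Padic.isDenseInducing_cast_withVal.dense (uniformContinuous_ratToCompletion v p hv)).continuous

/-- The condition is closed and holds on the natural numbers, which are dense in `ℤ_p`. -/
theorem norm_padicToCompletion_le_one (z : ℤ_[p]) : ‖padicToCompletion v p hv z‖ ≤ 1 := by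
  have hc : IsClosed {z : ℤ_[p] | ‖padicToCompletion v p hv z‖ ≤ 1} :=
    isClosed_le (continuous_norm.comp
      ((continuous_padicToCompletion v p hv).comp continuous_subtype_val)) continuous_const
  refine PadicInt.denseRange_natCast.induction_on z hc fun n => ?_
  have := FinitePlace.norm_le_one F v (n : 𝓞 F)
  simpa using this

include hv in
omit [Fact p.Prime] in
theorem norm_embedding_prime_lt_one : ‖FinitePlace.embedding v (p : F)‖ < 1 := by
  simpa using (FinitePlace.norm_lt_one_iff_mem F v (p : 𝓞 F)).2 hv

theorem norm_completion_add_le_max (a b : v.adicCompletion F) : ‖a + b‖ ≤ max ‖a‖ ‖b‖ := by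
  rw [FinitePlace.norm_def, FinitePlace.norm_def, FinitePlace.norm_def, ← NNReal.coe_max]
  have hm := (WithZeroMulInt.toNNReal_strictMono
    (NumberField.HeightOneSpectrum.one_lt_absNorm_nnreal v)).monotone
  rw [← hm.map_max]
  exact_mod_cast hm (Valued.v.map_add a b)

theorem norm_embedding_le_one_iff (x : F) :
    ‖FinitePlace.embedding v x‖ ≤ 1 ↔ v.valuation F x ≤ 1 := by
  rw [← (WithZeroMulInt.toNNReal_strictMono
    (NumberField.HeightOneSpectrum.one_lt_absNorm_nnreal v)).le_iff_le, map_one,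
    FinitePlace.norm_embedding']
  norm_cast

theorem norm_embedding_lt_of_valuation_le {x : F} {n : ℕ} {ε : ℝ}
    (hn : ((Ideal.absNorm v.asIdeal : ℕ) : ℝ)⁻¹ ^ n < ε)
    (hx : v.valuation F x ≤ exp (-n : ℤ)) : ‖FinitePlace.embedding v x‖ < ε := by
  rw [FinitePlace.norm_embedding']
  refine lt_of_le_of_lt ?_ hn
  have h4 := (WithZeroMulInt.toNNReal_strictMono
    (NumberField.HeightOneSpectrum.one_lt_absNorm_nnreal v)).monotone hx
  have h5 : WithZeroMulInt.toNNReal (NumberField.HeightOneSpectrum.absNorm_ne_zero v)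
      (exp (-n : ℤ)) = ((Ideal.absNorm v.asIdeal : NNReal)⁻¹) ^ n := by
    rw [WithZeroMulInt.toNNReal_neg_apply _ (by simp)]
    rw [← zpow_natCast, inv_zpow', NNReal.coe_inj.symm]
    rfl
  rw [h5] at h4
  exact_mod_cast h4

theorem exists_absNorm_inv_pow_lt {ε : ℝ} (hε : 0 < ε) :
    ∃ n : ℕ, ((Ideal.absNorm v.asIdeal : ℕ) : ℝ)⁻¹ ^ n < ε := by
  have hN : 1 < ((Ideal.absNorm v.asIdeal : ℕ) : ℝ) := by
    exact_mod_cast NumberField.HeightOneSpectrum.one_lt_absNorm v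
  exact exists_pow_lt_of_lt_one hε (inv_lt_one_of_one_lt₀ hN)

/-- Every element of the unit ball of `F_v` is a limit of algebraic integers. -/
theorem exists_integer_norm_sub_lt {x : v.adicCompletion F} (hx : ‖x‖ ≤ 1) {ε : ℝ} (hε : 0 < ε) :
    ∃ r : 𝓞 F, ‖FinitePlace.embedding v (r : F) - x‖ < ε := by
  -- The extra bound `1` forces `a` itself into the unit ball, so it can be replaced by an algebraic
  -- integer.
  obtain ⟨a, ha⟩ := (denseRange_algebraMap F v).exists_dist_lt x (lt_min hε one_pos)
  change dist x (FinitePlace.embedding v a) < _ at ha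
  rw [dist_comm, dist_eq_norm] at ha
  obtain ⟨ha1, ha2⟩ := lt_min_iff.1 ha
  have han : ‖FinitePlace.embedding v a‖ ≤ 1 := by
    have := norm_completion_add_le_max v (FinitePlace.embedding v a - x) x
    rw [sub_add_cancel] at this
    exact this.trans (max_le ha2.le hx)
  obtain ⟨n, hn⟩ := exists_absNorm_inv_pow_lt v hε
  obtain ⟨r, hr⟩ := v.exists_valuation_sub_lt_of_integer ((norm_embedding_le_one_iff v a).1 han)
    (Units.mk0 (exp (-n : ℤ)) exp_ne_zero)
  have h1 := norm_embedding_lt_of_valuation_le v hn hr.le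
  refine ⟨r, ?_⟩
  have := norm_completion_add_le_max v (FinitePlace.embedding v ((r : F) - a))
    (FinitePlace.embedding v a - x)
  rw [map_sub, sub_add_sub_cancel] at this
  rw [map_sub] at h1
  exact this.trans_lt (max_lt h1 ha1)

/-! ### Integral coordinates and the product of the completions above `p` -/

variable (F) in
/-- The primes of `F` above `p`. -/
abbrev PrimesAbove : Type _ := {v : HeightOneSpectrum (𝓞 F) // (p : 𝓞 F) ∈ v.asIdeal}

theorem finite_primes_mem {x : 𝓞 F} (hx : x ≠ 0) :
    {v : HeightOneSpectrum (𝓞 F) | x ∈ v.asIdeal}.Finite := by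
  simp_rw [← Ideal.dvd_span_singleton]
  exact Ideal.finite_factors (by simpa using hx)

instance finite_primesAbove : Finite (PrimesAbove F p) :=
  (finite_primes_mem (by exact_mod_cast (Fact.out : p.Prime).ne_zero)).to_subtype

/-- The completions above `p` as `ℚ_p`-algebras. -/
@[reducible]
noncomputable def primesAboveAlgebra (v : PrimesAbove F p) :
    Algebra ℚ_[p] (v.1.adicCompletion F) := completionAlgebra v.1 p v.2

attribute [local instance] primesAboveAlgebra

variable (F) in
/-- The diagonal embedding of `F` in the product of its completions above `p`. -/
noncomputable def diag : F →+* Π v : PrimesAbove F p, v.1.adicCompletion F :=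
  RingHom.pi fun v => FinitePlace.embedding v.1

variable (F) in
/-- The map `ℚ_p ⊗ F → ∏_{v ∣ p} F_v`, in terms of the coordinates of an integral basis of `F`. -/
noncomputable def coordToCompletions :
    (Module.Free.ChooseBasisIndex ℤ (𝓞 F) → ℚ_[p]) →ₗ[ℚ_[p]]
      Π v : PrimesAbove F p, v.1.adicCompletion F :=
  Fintype.linearCombination ℚ_[p] fun i => diag F p (integralBasis F i)

theorem coordToCompletions_apply (c : Module.Free.ChooseBasisIndex ℤ (𝓞 F) → ℚ_[p])
    (v : PrimesAbove F p) : coordToCompletions F p c v =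
      ∑ i, padicToCompletion v.1 p v.2 (c i) * FinitePlace.embedding v.1 (integralBasis F i) := by
  simp only [coordToCompletions, Fintype.linearCombination_apply, Finset.sum_apply, Pi.smul_apply]
  rfl

theorem coordToCompletions_intCast (m : Module.Free.ChooseBasisIndex ℤ (𝓞 F) → ℤ)
    (v : PrimesAbove F p) : coordToCompletions F p (fun i => (m i : ℚ_[p])) v =
      FinitePlace.embedding v.1 ((∑ i, m i • RingOfIntegers.basis F i : 𝓞 F) : F) := by
  rw [coordToCompletions_apply]
  simp [integralBasis_apply]

theorem norm_coordToCompletions_le_one (c : Module.Free.ChooseBasisIndex ℤ (𝓞 F) → ℤ_[p])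
    (v : PrimesAbove F p) : ‖coordToCompletions F p (fun i => (c i : ℚ_[p])) v‖ ≤ 1 := by
  rw [coordToCompletions_apply]
  refine Finset.sum_induction _ (fun x => ‖x‖ ≤ 1)
    (fun a b ha hb => (norm_completion_add_le_max v.1 a b).trans (max_le ha hb)) (by simp) ?_
  intro i _
  rw [norm_mul]
  refine mul_le_one₀ (norm_padicToCompletion_le_one v.1 p v.2 (c i)) (norm_nonneg _) ?_
  rw [integralBasis_apply]
  exact FinitePlace.norm_le_one F v.1 _

/-- The quotient `x / p^k` is integral at the places above `p` by hypothesis, and elsewhere because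
`p` is a unit there. -/
theorem prime_pow_dvd_of_norm_le {x : 𝓞 F} {k : ℕ}
    (h : ∀ v : PrimesAbove F p, ‖FinitePlace.embedding v.1 (x : F)‖ ≤
      ‖FinitePlace.embedding v.1 (p : F)‖ ^ k) : (p : 𝓞 F) ^ k ∣ x := by
  have hp0 : (p : F) ≠ 0 := by exact_mod_cast (Fact.out : p.Prime).ne_zero
  have hpk : (p : F) ^ k ≠ 0 := pow_ne_zero _ hp0
  have key : ∀ v : HeightOneSpectrum (𝓞 F), v.valuation F ((x : F) / (p : F) ^ k) ≤ 1 := by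
    intro v
    by_cases hv : (p : 𝓞 F) ∈ v.asIdeal
    · rw [← norm_embedding_le_one_iff, map_div₀, map_pow, norm_div, norm_pow]
      exact div_le_one_of_le₀ (h ⟨v, hv⟩) (by positivity)
    · have h1 : v.valuation F (algebraMap (𝓞 F) F (p : 𝓞 F)) = 1 := by
        rw [v.valuation_of_algebraMap, v.intValuation_eq_one_iff]
        exact hv
      rw [map_natCast] at h1
      rw [map_div₀, map_pow, h1, one_pow, div_one]
      exact v.valuation_le_one x
  obtain ⟨y, hy⟩ := HeightOneSpectrum.mem_integers_of_valuation_le_one F _ key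
  refine ⟨y, ?_⟩
  apply RingOfIntegers.coe_injective
  rw [eq_div_iff hpk] at hy
  rw [map_mul, map_pow, map_natCast, mul_comm]
  exact hy.symm

/-- Truncate the coordinates modulo `p^k` to integers. The resulting algebraic integer is divisible
by `p^k` at every place above `p`, hence in `𝓞 F`, so its coordinates in the integral basis are
divisible by `p^k`. Thus every `c i` lies in `p^k ℤ_p` for all `k`. -/
theorem coord_eq_zero_of_integral {c : Module.Free.ChooseBasisIndex ℤ (𝓞 F) → ℤ_[p]}
    (h : coordToCompletions F p (fun i => (c i : ℚ_[p])) = 0) : c = 0 := by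
  have hp : p.Prime := Fact.out
  have key : ∀ (k : ℕ) (i), ‖c i‖ ≤ (p : ℝ) ^ (-k : ℤ) := by
    intro k
    set n : Module.Free.ChooseBasisIndex ℤ (𝓞 F) → ℤ := fun i => ((c i).appr k : ℤ) with hn
    have hd : ∀ i, ∃ d : ℤ_[p], c i - (n i : ℤ_[p]) = (p : ℤ_[p]) ^ k * d := by
      intro i
      have := PadicInt.appr_spec k (c i)
      rw [Ideal.mem_span_singleton] at this
      rw [hn, Int.cast_natCast]
      exact this
    choose d hd using hd
    set y : 𝓞 F := ∑ i, n i • RingOfIntegers.basis F i with hy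
    have h1 : (p : 𝓞 F) ^ k ∣ y := by
      refine prime_pow_dvd_of_norm_le p fun v => ?_
      rw [hy, ← coordToCompletions_intCast]
      have e : (fun i => (n i : ℚ_[p])) = (fun i => (c i : ℚ_[p])) +
          (-(p : ℚ_[p]) ^ k) • fun i => (d i : ℚ_[p]) := by
        ext i
        have := congrArg (Subtype.val) (hd i)
        simp only [PadicInt.coe_sub, PadicInt.coe_mul, PadicInt.coe_pow, PadicInt.coe_natCast,
          PadicInt.coe_intCast] at this
        simp only [Pi.add_apply, Pi.smul_apply, smul_eq_mul]
        linear_combination -this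
      rw [e, map_add, h, zero_add, map_smul, Pi.smul_apply, Algebra.smul_def, norm_mul]
      have e2 : algebraMap ℚ_[p] (v.1.adicCompletion F) (-(p : ℚ_[p]) ^ k) =
          -(FinitePlace.embedding v.1 (p : F)) ^ k := by simp
      rw [e2, norm_neg, norm_pow]
      exact mul_le_of_le_one_right (by positivity) (norm_coordToCompletions_le_one p d v)
    obtain ⟨w, hw⟩ := h1
    intro i
    have h2 : n i = (p : ℤ) ^ k * (RingOfIntegers.basis F).repr w i := by
      have := congrArg (fun z => (RingOfIntegers.basis F).repr z i) hw
      have e : (p : 𝓞 F) ^ k * w = ((p : ℤ) ^ k) • w := by simp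
      simp only [e, map_smul, hy, Module.Basis.repr_sum_self, Finsupp.smul_apply, smul_eq_mul] at this
      exact this
    rw [PadicInt.norm_le_pow_iff_mem_span_pow, Ideal.mem_span_singleton]
    have h3 : c i = (p : ℤ_[p]) ^ k * (d i + ((RingOfIntegers.basis F).repr w i : ℤ)) := by
      rw [mul_add, ← hd i, h2]; push_cast; ring
    exact ⟨_, h3⟩
  ext1 i
  by_contra hne
  have hpos : 0 < ‖c i‖ := norm_pos_iff.2 hne
  obtain ⟨k, hk⟩ := PadicInt.exists_pow_neg_lt p hpos
  exact absurd (key k i) (not_le.2 hk)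

theorem exists_pow_smul_integral {ι : Type*} [Finite ι] (c : ι → ℚ_[p]) :
    ∃ (k : ℕ) (d : ι → ℤ_[p]), ∀ i, (p : ℚ_[p]) ^ k * c i = d i := by
  have := Fintype.ofFinite ι
  have hp : p.Prime := Fact.out
  have h1 : ∀ i, ∃ k : ℕ, ‖c i‖ ≤ (p : ℝ) ^ k := fun i =>
    (pow_unbounded_of_one_lt ‖c i‖ (by exact_mod_cast hp.one_lt)).imp fun _ h => h.le
  choose k hk using h1
  have h2 : ∀ i, ‖(p : ℚ_[p]) ^ (Finset.univ.sup k) * c i‖ ≤ 1 := by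
    intro i
    have hp1 : (1 : ℝ) ≤ p := by exact_mod_cast hp.one_lt.le
    have hle : ‖c i‖ ≤ (p : ℝ) ^ Finset.univ.sup k :=
      (hk i).trans (pow_le_pow_right₀ hp1 (Finset.le_sup (Finset.mem_univ i)))
    rw [norm_mul, norm_pow, Padic.norm_p, inv_pow, inv_mul_le_iff₀ (by positivity), mul_one]
    exact hle
  exact ⟨Finset.univ.sup k, fun i => ⟨_, h2 i⟩, fun i => rfl⟩

theorem coordToCompletions_injective : Function.Injective (coordToCompletions F p) := by
  rw [injective_iff_map_eq_zero]
  intro c hc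
  obtain ⟨k, d, hd⟩ := exists_pow_smul_integral p c
  have h : coordToCompletions F p (fun i => (d i : ℚ_[p])) = 0 := by
    have : (fun i => (d i : ℚ_[p])) = (p : ℚ_[p]) ^ k • c := by ext i; simp [hd]
    rw [this, map_smul, hc, smul_zero]
  have h0 := coord_eq_zero_of_integral p h
  ext i
  have := hd i
  rw [h0] at this
  simpa [(Fact.out : p.Prime).ne_zero] using this

/-- Approximate at each place separately, then glue by the Chinese remainder theorem. -/
theorem exists_integer_forall_norm_sub_lt (x : Π v : PrimesAbove F p, v.1.adicCompletion F)
    (hx : ∀ v, ‖x v‖ ≤ 1) {ε : ℝ} (hε : 0 < ε) :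
    ∃ r : 𝓞 F, ∀ v : PrimesAbove F p, ‖FinitePlace.embedding v.1 (r : F) - x v‖ < ε := by
  have := Fintype.ofFinite (PrimesAbove F p)
  choose r hr using fun v : PrimesAbove F p => exists_integer_norm_sub_lt v.1 (hx v) hε
  choose n hn using fun v : PrimesAbove F p => exists_absNorm_inv_pow_lt v.1 hε
  obtain ⟨y, hy⟩ := IsDedekindDomain.exists_forall_sub_mem_ideal (s := Finset.univ)
    (fun v : PrimesAbove F p => v.1.asIdeal) n (fun v _ => v.1.prime)
    (fun v _ w _ hvw h => hvw (Subtype.ext (HeightOneSpectrum.ext h))) (fun v => r v.1)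
  refine ⟨y, fun v => ?_⟩
  have h1 : ‖FinitePlace.embedding v.1 (((y - r v : 𝓞 F)) : F)‖ < ε := by
    refine norm_embedding_lt_of_valuation_le v.1 (hn v) ?_
    rw [v.1.valuation_of_algebraMap, v.1.intValuation_le_pow_iff_mem]
    exact hy v (Finset.mem_univ v)
  have he : ((y - r v : 𝓞 F) : F) = (y : F) - (r v : F) := map_sub (algebraMap (𝓞 F) F) _ _
  have := norm_completion_add_le_max v.1 (FinitePlace.embedding v.1 (((y - r v : 𝓞 F)) : F))
    (FinitePlace.embedding v.1 (r v : F) - x v)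
  rw [he, map_sub (FinitePlace.embedding v.1), sub_add_sub_cancel] at this
  rw [he, map_sub (FinitePlace.embedding v.1)] at h1
  exact this.trans_lt (max_lt h1 (hr v))

/-- The image of the compact set of `ℤ_p`-coordinates is closed, and it contains `𝓞 F`, which is
dense in the product of unit balls. -/
theorem exists_coord_of_norm_le_one (x : Π v : PrimesAbove F p, v.1.adicCompletion F)
    (hx : ∀ v, ‖x v‖ ≤ 1) : ∃ c, coordToCompletions F p c = x := by
  have := Fintype.ofFinite (PrimesAbove F p)
  let f : (Module.Free.ChooseBasisIndex ℤ (𝓞 F) → ℤ_[p]) →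
      Π v : PrimesAbove F p, v.1.adicCompletion F :=
    fun c => coordToCompletions F p fun i => (c i : ℚ_[p])
  have hf : Continuous f := by
    refine continuous_pi fun v => ?_
    simp only [f, coordToCompletions_apply]
    refine continuous_finsetSum _ fun i _ => Continuous.mul ?_ continuous_const
    exact (continuous_padicToCompletion v.1 p v.2).comp
      (continuous_subtype_val.comp (continuous_apply i))
  have hc : IsClosed (Set.range f) := (isCompact_range hf).isClosed
  have hmem : x ∈ closure (Set.range f) := by
    rw [Metric.mem_closure_iff]
    intro ε hε
    obtain ⟨r, hr⟩ := exists_integer_forall_norm_sub_lt p x hx hε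
    refine ⟨_, ⟨fun i => ((RingOfIntegers.basis F).repr r i : ℤ_[p]), rfl⟩, ?_⟩
    rw [dist_pi_lt_iff hε]
    intro v
    rw [dist_comm, dist_eq_norm]
    have := coordToCompletions_intCast p (fun i => (RingOfIntegers.basis F).repr r i) v
    rw [Module.Basis.sum_repr] at this
    simp only [f, PadicInt.coe_intCast, this]
    exact hr v
  rw [hc.closure_eq] at hmem
  obtain ⟨c, hc⟩ := hmem
  exact ⟨_, hc⟩

theorem coordToCompletions_surjective : Function.Surjective (coordToCompletions F p) := by
  intro x
  have := Fintype.ofFinite (PrimesAbove F p)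
  have h1 : ∀ v : PrimesAbove F p, ∃ k : ℕ, ∀ m ≥ k,
      ‖FinitePlace.embedding v.1 (p : F) ^ m * x v‖ ≤ 1 := by
    intro v
    have ht : Tendsto (fun m : ℕ => ‖FinitePlace.embedding v.1 (p : F) ^ m * x v‖) atTop
        (𝓝 0) := by
      have := (tendsto_pow_atTop_nhds_zero_of_norm_lt_one
        (norm_embedding_prime_lt_one v.1 p v.2)).mul_const (x v)
      simpa using this.norm
    exact eventually_atTop.1 (ht.eventually (ge_mem_nhds one_pos))
  choose k hk using h1
  set m := Finset.univ.sup k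
  have hp0 : (p : ℚ_[p]) ^ m ≠ 0 := pow_ne_zero _ (by exact_mod_cast (Fact.out : p.Prime).ne_zero)
  obtain ⟨c, hc⟩ := exists_coord_of_norm_le_one p ((p : ℚ_[p]) ^ m • x) (by
    intro v
    have := hk v m (Finset.le_sup (Finset.mem_univ v))
    rw [Pi.smul_apply, Algebra.smul_def]
    simpa using this)
  exact ⟨((p : ℚ_[p]) ^ m)⁻¹ • c, by rw [map_smul, hc, inv_smul_smul₀ hp0]⟩

/-! ### Global norm and local norms -/

variable (F) in
/-- The basis of `∏_{v ∣ p} F_v` over `ℚ_p` given by an integral basis of `F`. -/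
noncomputable def completionsBasis : Module.Basis (Module.Free.ChooseBasisIndex ℤ (𝓞 F)) ℚ_[p]
    (Π v : PrimesAbove F p, v.1.adicCompletion F) :=
  (Pi.basisFun ℚ_[p] _).map (LinearEquiv.ofBijective (coordToCompletions F p)
    ⟨coordToCompletions_injective p, coordToCompletions_surjective p⟩)

theorem completionsBasis_apply (i) : completionsBasis F p i = diag F p (integralBasis F i) := by
  simp [completionsBasis, coordToCompletions, Fintype.linearCombination_apply_single]

/-- Ensures that `Algebra.norm` and `Module.finrank` are genuine here and do not take their default
values `1` and `0`. -/
instance finiteDimensional_primesAbove (v : PrimesAbove F p) :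
    FiniteDimensional ℚ_[p] (v.1.adicCompletion F) := by
  classical
  have := (completionsBasis F p).finiteDimensional_of_finite
  exact Module.Finite.of_surjective
    (LinearMap.proj v : (Π v : PrimesAbove F p, v.1.adicCompletion F) →ₗ[ℚ_[p]] _)
    (LinearMap.proj_surjective v)

/-- In the basis coming from an integral basis of `F`, multiplication by `x` has the same matrix
over `ℚ_p` as over `ℚ`. -/
theorem norm_diag (x : F) :
    Algebra.norm ℚ_[p] (diag F p x) = ((Algebra.norm ℚ x : ℚ) : ℚ_[p]) := by
  classical
  have h : Algebra.leftMulMatrix (completionsBasis F p) (diag F p x) =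
      (Algebra.leftMulMatrix (integralBasis F) x).map (algebraMap ℚ ℚ_[p]) := by
    ext i j
    rw [Algebra.leftMulMatrix_apply, LinearMap.toMatrix_apply, Matrix.map_apply]
    have h1 : (Algebra.lmul ℚ_[p] _ (diag F p x)) (completionsBasis F p j) =
        ∑ i, (algebraMap ℚ ℚ_[p] (Algebra.leftMulMatrix (integralBasis F) x i j)) •
          completionsBasis F p i := by
      have h2 : x * integralBasis F j = ∑ i, (Algebra.leftMulMatrix (integralBasis F) x i j) •
          integralBasis F i := by
        conv_lhs => rw [← (integralBasis F).sum_repr (x * integralBasis F j)]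
        simp [Algebra.leftMulMatrix_eq_repr_mul]
      simp only [completionsBasis_apply]
      change diag F p x * diag F p (integralBasis F j) = _
      rw [← map_mul, h2, map_sum]
      refine Finset.sum_congr rfl fun i _ => ?_
      rw [Algebra.smul_def, Algebra.smul_def, map_mul]
      congr 1
      refine funext fun v => ?_
      change FinitePlace.embedding v.1 (algebraMap ℚ F _) =
        padicToCompletion v.1 p v.2 (algebraMap ℚ ℚ_[p] _)
      rw [eq_ratCast, eq_ratCast, map_ratCast, map_ratCast]
    rw [h1, Module.Basis.repr_sum_self]
  rw [Algebra.norm_eq_matrix_det (completionsBasis F p), h, Algebra.norm_eq_matrix_det (integralBasis F)]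
  exact (RingHom.map_det (algebraMap ℚ ℚ_[p]) _).symm

theorem det_blockDiagonal' {R ι : Type*} [CommRing R] [Fintype ι] [DecidableEq ι] {m : ι → Type*}
    [∀ i, Fintype (m i)] [∀ i, DecidableEq (m i)] (M : Π i, Matrix (m i) (m i) R) :
    (Matrix.blockDiagonal' M).det = ∏ i, (M i).det := by
  let : LinearOrder ι := LinearOrder.lift' (Fintype.equivFin ι) (Fintype.equivFin ι).injective
  rw [(Matrix.blockTriangular_blockDiagonal' M).det_fintype]
  refine Finset.prod_congr rfl fun i _ => ?_
  let e : m i ≃ {a : Sigma m // a.1 = i} :=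
    { toFun := fun k => ⟨⟨i, k⟩, rfl⟩
      invFun := fun a => a.2 ▸ a.1.2
      left_inv := fun k => rfl
      right_inv := by rintro ⟨⟨j, k⟩, rfl⟩; rfl }
  rw [← Matrix.det_submatrix_equiv_self e]
  congr 1
  ext k l
  simp [e, Matrix.toSquareBlock_def]

theorem norm_pi {K ι : Type*} [Field K] [Fintype ι] {A : ι → Type*} [∀ i, CommRing (A i)]
    [∀ i, Algebra K (A i)] [∀ i, FiniteDimensional K (A i)] (x : Π i, A i) :
    Algebra.norm K x = ∏ i, Algebra.norm K (x i) := by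
  classical
  let b := fun i => Module.finBasis K (A i)
  have h : Algebra.leftMulMatrix (Pi.basis b) x =
      Matrix.blockDiagonal' fun i => Algebra.leftMulMatrix (b i) (x i) := by
    ext ⟨i, k⟩ ⟨j, l⟩
    rw [Algebra.leftMulMatrix_eq_repr_mul, Pi.basis_repr, Pi.basis_apply, Matrix.blockDiagonal'_apply]
    split_ifs with hij
    · obtain rfl : i = j := hij
      simp [Algebra.leftMulMatrix_eq_repr_mul]
    · simp [Pi.single_eq_of_ne hij]
  rw [Algebra.norm_eq_matrix_det (Pi.basis b), h, det_blockDiagonal']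
  exact Finset.prod_congr rfl fun i _ => (Algebra.norm_eq_matrix_det (b i) (x i)).symm

/-- The global norm is the product of the local norms. -/
theorem prod_localNorm [Fintype (PrimesAbove F p)] (x : F) :
    ∏ v : PrimesAbove F p, localNorm v.1 p v.2 (FinitePlace.embedding v.1 x) =
      ((Algebra.norm ℚ x : ℚ) : ℚ_[p]) := by
  rw [← norm_diag, norm_pi]
  rfl

theorem localNorm_ne_zero {x : v.adicCompletion F} (hx : x ≠ 0) : localNorm v p hv x ≠ 0 := by
  let := completionAlgebra v p hv
  have := finiteDimensional_primesAbove (F := F) p ⟨v, hv⟩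
  exact Algebra.norm_ne_zero_iff.2 hx

theorem cyclotomicDegree_ne_zero (k K : Type*) [Field k] [Field K] [Algebra k K]
    [FiniteDimensional k K] : cyclotomicDegree k K ≠ 0 := by
  have h1 : FiniteDimensional k (IsScalarTower.toAlgHom k K (AlgebraicClosure K)).fieldRange :=
    Module.Finite.of_surjective
      ((AlgEquiv.ofInjectiveField (IsScalarTower.toAlgHom k K (AlgebraicClosure K))).toLinearMap)
      (AlgEquiv.ofInjectiveField (IsScalarTower.toAlgHom k K (AlgebraicClosure K))).surjective
  have h2 : FiniteDimensional k ↥(cyclotomicZHat k (AlgebraicClosure K) ⊓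
      (IsScalarTower.toAlgHom k K (AlgebraicClosure K)).fieldRange) :=
    Module.Finite.of_injective (IntermediateField.inclusion (inf_le_right :
      cyclotomicZHat k (AlgebraicClosure K) ⊓ _ ≤ _)).toLinearMap
      (RingHom.injective _)
  exact (Module.finrank_pos (R := k)).ne'

theorem logInertiaDeg_ne_zero : logInertiaDeg v ≠ 0 := by
  have : Fact (residueChar v).Prime := ⟨residueChar_prime v⟩
  have := finiteDimensional_primesAbove (F := F) (residueChar v) ⟨v, residueChar_mem v⟩
  let := completionAlgebra v (residueChar v) (residueChar_mem v)
  exact cyclotomicDegree_ne_zero ℚ_[residueChar v] (v.adicCompletion F)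

end LocalGlobal

/-! ### The product formula for logarithmic valuations -/

section ProductFormula

variable {F : Type*} [Field F] [NumberField F] {ℓ : ℕ} [Fact ℓ.Prime]

theorem exists_absNorm_eq_residueChar_pow (v : HeightOneSpectrum (𝓞 F)) :
    ∃ n : ℕ, Ideal.absNorm v.asIdeal = residueChar v ^ n := by
  have : Finite (𝓞 F ⧸ v.asIdeal) := v.asIdeal.finiteQuotientOfFreeOfNeBot v.ne_bot
  have := Fintype.ofFinite (𝓞 F ⧸ v.asIdeal)
  let := Ideal.Quotient.field v.asIdeal
  obtain ⟨n, -, hn⟩ := FiniteField.card (𝓞 F ⧸ v.asIdeal) (residueChar v)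
  refine ⟨n, ?_⟩
  rw [Ideal.absNorm_apply, Submodule.cardQuot_apply, Nat.card_eq_fintype_card]
  exact hn

theorem absNorm_cast_ne_zero (v : HeightOneSpectrum (𝓞 F)) (K : Type*) [DivisionRing K]
    [CharZero K] : ((Ideal.absNorm v.asIdeal : ℕ) : K) ≠ 0 := by
  exact_mod_cast (zero_lt_one.trans (NumberField.HeightOneSpectrum.one_lt_absNorm v)).ne'

omit [Fact ℓ.Prime] in
theorem residueChar_ne_of_notMem {v : HeightOneSpectrum (𝓞 F)} (hv : (ℓ : 𝓞 F) ∉ v.asIdeal) :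
    residueChar v ≠ ℓ := fun h => hv (h ▸ residueChar_mem v)

theorem iwasawaLog_absNorm_of_mem {v : HeightOneSpectrum (𝓞 F)} (hv : (ℓ : 𝓞 F) ∈ v.asIdeal) :
    iwasawaLog ℓ (Ideal.absNorm v.asIdeal : ℚ_[ℓ]) = 0 := by
  obtain ⟨n, hn⟩ := exists_absNorm_eq_residueChar_pow v
  rw [residueChar_eq Fact.out hv] at hn
  have h0 : (ℓ : ℚ_[ℓ]) ≠ 0 := by exact_mod_cast (Fact.out : ℓ.Prime).ne_zero
  rw [hn, Nat.cast_pow, ← zpow_natCast, iwasawaLog_zpow h0, iwasawaLog_self, mul_zero]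

theorem deg_ne_zero_of_mem {v : HeightOneSpectrum (𝓞 F)} (hv : (ℓ : 𝓞 F) ∈ v.asIdeal) :
    deg ℓ v ≠ 0 := by
  have h0 : (ℓ : ℚ_[ℓ]) ≠ 0 := by exact_mod_cast (Fact.out : ℓ.Prime).ne_zero
  refine mul_ne_zero (by exact_mod_cast logInertiaDeg_ne_zero v) ?_
  rw [degPrime, if_pos (residueChar_eq Fact.out hv)]
  split_ifs
  · norm_num
  · exact h0

theorem iwasawaLog_absNorm_eq_zero_of_deg {v : HeightOneSpectrum (𝓞 F)}
    (hv : (ℓ : 𝓞 F) ∉ v.asIdeal) (h : deg ℓ v = 0) :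
    iwasawaLog ℓ (Ideal.absNorm v.asIdeal : ℚ_[ℓ]) = 0 := by
  have h1 : ((logInertiaDeg v : ℕ) : ℚ_[ℓ]) ≠ 0 := by exact_mod_cast logInertiaDeg_ne_zero v
  have h2 := (mul_eq_zero.1 h).resolve_left h1
  rw [degPrime, if_neg (residueChar_ne_of_notMem hv)] at h2
  obtain ⟨n, hn⟩ := exists_absNorm_eq_residueChar_pow v
  have h0 : (residueChar v : ℚ_[ℓ]) ≠ 0 := by exact_mod_cast (residueChar_prime v).ne_zero
  rw [hn, Nat.cast_pow, ← zpow_natCast, iwasawaLog_zpow h0, h2, mul_zero]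

theorem logVal_of_notMem {v : HeightOneSpectrum (𝓞 F)} (hv : (ℓ : 𝓞 F) ∉ v.asIdeal)
    (x : v.adicCompletion F) : logVal ℓ v x =
      (WithZero.log (Valued.v x) : ℤ) * (-iwasawaLog ℓ (Ideal.absNorm v.asIdeal : ℚ_[ℓ]) / deg ℓ v) := by
  rw [logVal, dif_neg hv, iwasawaLog_zpow (absNorm_cast_ne_zero v _)]
  ring

open Classical in
-- Away from `ℓ` the degree need not be known to be nonzero: if it vanished, `Log (N v)` would
-- vanish as well, consistently with division by zero giving `0`.
theorem logVal_mul_deg (v : HeightOneSpectrum (𝓞 F)) (x : v.adicCompletion F) :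
    logVal ℓ v x * deg ℓ v = if h : (ℓ : 𝓞 F) ∈ v.asIdeal then -iwasawaLog ℓ (localNorm v ℓ h x)
      else -iwasawaLog ℓ ((Ideal.absNorm v.asIdeal : ℚ_[ℓ]) ^ (WithZero.log (Valued.v x))) := by
  rw [logVal]
  split_ifs with h
  · rw [div_mul_cancel₀ _ (deg_ne_zero_of_mem h)]
  · by_cases h0 : deg ℓ v = 0
    · rw [iwasawaLog_zpow (absNorm_cast_ne_zero v _), iwasawaLog_absNorm_eq_zero_of_deg h h0]
      simp
    · rw [div_mul_cancel₀ _ h0]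

theorem divDeg_eq_sum (D : RatDiv ℓ F) (s : Finset (HeightOneSpectrum (𝓞 F)))
    (hs : ∀ v ∉ s, D v = 0) : divDeg ℓ F D = ∑ v ∈ s, D v * deg ℓ v := by
  classical
  have h : D = ∑ v ∈ s, DirectSum.lof ℤ_[ℓ] _ (fun _ => ℚ_[ℓ]) v (D v) := by
    refine DFinsupp.ext fun w => ?_
    rw [DFinsupp.finsetSum_apply]
    by_cases hw : w ∈ s
    · rw [Finset.sum_eq_single w]
      · exact (DirectSum.of_eq_same (β := fun _ => ℚ_[ℓ]) w (D w)).symm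
      · intro v _ hvw
        exact DirectSum.of_eq_of_ne (β := fun _ => ℚ_[ℓ]) v w _ hvw.symm
      · exact fun h => absurd hw h
    · rw [hs w hw]
      refine (Finset.sum_eq_zero fun v hv => ?_).symm
      exact DirectSum.of_eq_of_ne (β := fun _ => ℚ_[ℓ]) v w _ (by rintro rfl; exact hw hv)
  conv_lhs => rw [h, map_sum]
  refine Finset.sum_congr rfl fun v _ => ?_
  rw [divDeg]
  convert DirectSum.toModule_lof (M := fun _ => ℚ_[ℓ]) ℤ_[ℓ] v (D v)
  rfl

theorem valued_embedding (v : HeightOneSpectrum (𝓞 F)) (x : F) :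
    Valued.v (FinitePlace.embedding v x) = v.valuation F x :=
  valuedAdicCompletion_eq_valuation' v x

theorem norm_embedding_eq_absNorm_zpow (v : HeightOneSpectrum (𝓞 F)) {x : F} (hx : x ≠ 0) :
    ‖FinitePlace.embedding v x‖ =
      ((Ideal.absNorm v.asIdeal : ℕ) : ℝ) ^ WithZero.log (v.valuation F x) := by
  have h0 : v.valuation F x ≠ 0 := (Valuation.ne_zero_iff _).2 hx
  rw [FinitePlace.norm_embedding', ← exp_log h0, WithZeroMulInt.toNNReal_neg_apply _ (by simp)]
  rfl

theorem finite_valuation_ne_one {x : F} (hx : x ≠ 0) :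
    {v : HeightOneSpectrum (𝓞 F) | v.valuation F x ≠ 1}.Finite := by
  have h := FinitePlace.hasFiniteMulSupport hx
  refine (h.image FinitePlace.maximalIdeal).subset fun v hv => ⟨FinitePlace.mk v, ?_, FinitePlace.maximalIdeal_mk v⟩
  rw [Function.mem_mulSupport, FinitePlace.mk_apply]
  intro h1
  refine hv ((norm_embedding_le_one_iff v x).1 h1.le |>.antisymm ?_)
  have := (norm_embedding_le_one_iff v x⁻¹).1 (by rw [map_inv₀, norm_inv, h1, inv_one])
  rw [map_inv₀] at this
  exact (inv_le_one₀ (zero_lt_iff.2 ((Valuation.ne_zero_iff _).2 hx))).1 this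

theorem prod_absNorm_zpow {x : F} (hx : x ≠ 0) (s : Finset (HeightOneSpectrum (𝓞 F)))
    (hs : ∀ v ∉ s, v.valuation F x = 1) :
    ∏ v ∈ s, ((Ideal.absNorm v.asIdeal : ℕ) : ℚ) ^ WithZero.log (v.valuation F x) =
      |Algebra.norm ℚ x|⁻¹ := by
  have h := FinitePlace.prod_eq_inv_abs_norm hx
  rw [← finprod_comp_equiv FinitePlace.equivHeightOneSpectrum.symm,
    finprod_eq_prod_of_mulSupport_subset (s := s)] at h
  · have h2 : ∀ v : HeightOneSpectrum (𝓞 F), FinitePlace.equivHeightOneSpectrum.symm v x =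
        ((Ideal.absNorm v.asIdeal : ℕ) : ℝ) ^ WithZero.log (v.valuation F x) :=
      fun v => norm_embedding_eq_absNorm_zpow v hx
    simp_rw [h2] at h
    apply Rat.cast_injective (α := ℝ)
    push_cast
    push_cast at h
    exact h
  · intro v hv
    by_contra hvs
    refine hv ?_
    change ‖FinitePlace.embedding v x‖ = 1
    rw [norm_embedding_eq_absNorm_zpow v hx, hs v hvs, log_one, zpow_zero]

/-- The local norms above `ℓ` contribute `-Log N(a)` in total, the places away from `ℓ` contribute
`Log |N(a)|`, and `Log` ignores the sign. -/
theorem divDeg_eq_zero_of_principal {a : F} (ha : a ≠ 0) {D : RatDiv ℓ F}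
    (hD : ∀ v, D v = logVal ℓ v (FinitePlace.embedding v a)) : divDeg ℓ F D = 0 := by
  classical
  have := Fintype.ofFinite (PrimesAbove F ℓ)
  have hN : ((Algebra.norm ℚ a : ℚ) : ℚ_[ℓ]) ≠ 0 := by
    exact_mod_cast Algebra.norm_ne_zero_iff.2 ha
  set t : Finset (HeightOneSpectrum (𝓞 F)) := Finset.univ.image (fun v : PrimesAbove F ℓ => v.1)
  have ht : ∀ v, v ∈ t ↔ (ℓ : 𝓞 F) ∈ v.asIdeal := by simp [t]
  set s := DFinsupp.support D ∪ ((finite_valuation_ne_one ha).toFinset ∪ t) with hs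
  have hs1 : ∀ v ∉ s, D v = 0 := by
    intro v hv
    by_contra h
    exact hv (Finset.mem_union_left _ (DFinsupp.mem_support_iff.2 h))
  have hs2 : ∀ v ∉ s, v.valuation F a = 1 := by
    intro v hv
    by_contra h
    exact hv (Finset.mem_union_right _ (Finset.mem_union_left _ (by simpa using h)))
  have hts : t ⊆ s := Finset.subset_union_right.trans Finset.subset_union_right
  set g : HeightOneSpectrum (𝓞 F) → ℚ_[ℓ] := fun v =>
    iwasawaLog ℓ ((Ideal.absNorm v.asIdeal : ℚ_[ℓ]) ^ (WithZero.log (v.valuation F a))) with hg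
  -- Above `ℓ` the ideal norm is a power of `ℓ`, killed by `Log`; so the product formula over all
  -- finite places involves only those away from `ℓ` after taking `Log`.
  have hg0 : ∀ v ∈ t, g v = 0 := by
    intro v hv
    rw [hg]
    simp only
    rw [iwasawaLog_zpow (absNorm_cast_ne_zero v _), iwasawaLog_absNorm_of_mem ((ht v).1 hv), mul_zero]
  have hsum : ∑ v ∈ s, g v = -iwasawaLog ℓ ((Algebra.norm ℚ a : ℚ) : ℚ_[ℓ]) := by
    rw [hg, ← iwasawaLog_prod s _ fun v _ => zpow_ne_zero _ (absNorm_cast_ne_zero v _)]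
    have h1 := congrArg (Rat.cast (K := ℚ_[ℓ])) (prod_absNorm_zpow ha s hs2)
    push_cast at h1
    rw [h1, ← zpow_neg_one]
    rcases abs_choice (Algebra.norm ℚ a) with h | h
    · rw [h, iwasawaLog_zpow hN]; simp
    · rw [h, Rat.cast_neg, iwasawaLog_zpow (neg_ne_zero.2 hN), iwasawaLog_neg hN]; simp
  have hloc : ∑ v : PrimesAbove F ℓ, iwasawaLog ℓ (localNorm v.1 ℓ v.2 (FinitePlace.embedding v.1 a)) =
      iwasawaLog ℓ ((Algebra.norm ℚ a : ℚ) : ℚ_[ℓ]) := by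
    rw [← prod_localNorm, iwasawaLog_prod]
    intro v _
    exact localNorm_ne_zero v.1 ℓ v.2 ((map_ne_zero _).2 ha)
  rw [divDeg_eq_sum D s hs1]
  have hterm : ∀ v, D v * deg ℓ v = if h : (ℓ : 𝓞 F) ∈ v.asIdeal then
      -iwasawaLog ℓ (localNorm v ℓ h (FinitePlace.embedding v a)) else -g v := by
    intro v
    rw [hD, logVal_mul_deg, valued_embedding]
  have h1 : ∑ v ∈ t, D v * deg ℓ v = -iwasawaLog ℓ ((Algebra.norm ℚ a : ℚ) : ℚ_[ℓ]) := by
    rw [Finset.sum_image (by intro v _ w _ h; exact Subtype.ext h), ← hloc, ← Finset.sum_neg_distrib]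
    exact Finset.sum_congr rfl fun v _ => by rw [hterm, dif_pos v.2]
  have h2 : ∑ v ∈ s \ t, D v * deg ℓ v = iwasawaLog ℓ ((Algebra.norm ℚ a : ℚ) : ℚ_[ℓ]) := by
    rw [← neg_neg (iwasawaLog ℓ _), ← hsum, ← Finset.sum_sdiff hts, Finset.sum_eq_zero hg0, add_zero,
      ← Finset.sum_neg_distrib]
    refine Finset.sum_congr rfl fun v hv => ?_
    rw [hterm, dif_neg fun h => (Finset.mem_sdiff.1 hv).2 ((ht v).2 h)]
  rw [← Finset.sum_sdiff hts, h1, h2, add_neg_cancel]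

variable (ℓ) in
/-- Every `a ≠ 0` has a principal logarithmic divisor: almost all `ṽ_v(a)` vanish. -/
theorem exists_principal {a : F} (ha : a ≠ 0) :
    ∃ D : RatDiv ℓ F, ∀ v, D v = logVal ℓ v (FinitePlace.embedding v a) := by
  classical
  have hl : (ℓ : 𝓞 F) ≠ 0 := by exact_mod_cast (Fact.out : ℓ.Prime).ne_zero
  set s := (finite_valuation_ne_one ha).toFinset ∪ (finite_primes_mem hl).toFinset
  refine ⟨DFinsupp.mk s fun v => logVal ℓ v.1 (FinitePlace.embedding v.1 a), fun v => ?_⟩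
  refine (DFinsupp.mk_apply).trans ?_
  split_ifs with h
  · rfl
  · simp only [s, Finset.mem_union, Set.Finite.mem_toFinset, Set.mem_ofPred_eq, not_or, not_not] at h
    rw [logVal_of_notMem h.2, valued_embedding, h.1, log_one, Int.cast_zero, zero_mul]

theorem logPrincipal_le_logDivZero : logPrincipal ℓ F ≤ logDivZero ℓ F := by
  refine Submodule.span_le.2 ?_
  rintro D ⟨a, hD⟩
  refine ⟨fun v => ?_, divDeg_eq_zero_of_principal a.ne_zero hD⟩
  rw [hD]
  exact Submodule.subset_span ⟨Units.map (FinitePlace.embedding v).toMonoidHom a, rfl⟩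

end ProductFormula

/-! ### Generators of powers of primes modulo the primes above `ℓ` -/

section ClassGroup

open nonZeroDivisors

variable {F : Type*} [Field F] [NumberField F] {ℓ : ℕ} [Fact ℓ.Prime]

/-- Containing a power of `ℓ` expresses that `J` is supported above `ℓ`. Inverses stay representable
by integral ideals: take the cofactor of `J` in `(ℓ^k)`. -/
theorem exists_ideal_of_mem_primesAbove {c : ClassGroup (𝓞 F)} (hc : c ∈ primesAbove ℓ F) :
    ∃ (J : (Ideal (𝓞 F))⁰) (k : ℕ), ClassGroup.mk0 J = c ∧ (ℓ : 𝓞 F) ^ k ∈ (J : Ideal (𝓞 F)) := by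
  have hl : (ℓ : 𝓞 F) ≠ 0 := by exact_mod_cast (Fact.out : ℓ.Prime).ne_zero
  induction hc using Subgroup.closure_induction with
  | mem c hc =>
    obtain ⟨v, hv, rfl⟩ := hc
    exact ⟨_, 1, rfl, by simpa using hv⟩
  | one => exact ⟨1, 0, map_one _, by simp⟩
  | mul a b _ _ ha hb =>
    obtain ⟨J, k, rfl, hJ⟩ := ha
    obtain ⟨J', k', rfl, hJ'⟩ := hb
    refine ⟨J * J', k + k', map_mul _ _ _, ?_⟩
    rw [pow_add]
    exact Ideal.mul_mem_mul hJ hJ'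
  | inv a _ ha =>
    obtain ⟨J, k, rfl, hJ⟩ := ha
    obtain ⟨J', hJ'⟩ := Ideal.dvd_span_singleton.2 hJ
    have h0 : Ideal.span {(ℓ : 𝓞 F) ^ k} ≠ 0 := by
      rw [Submodule.zero_eq_bot, Ne, Ideal.span_singleton_eq_bot]
      exact pow_ne_zero _ hl
    have hJ0 : J' ∈ (Ideal (𝓞 F))⁰ := mem_nonZeroDivisors_of_ne_zero (by
      rintro rfl
      rw [mul_zero] at hJ'
      exact h0 hJ')
    refine ⟨⟨J', hJ0⟩, k, ?_, ?_⟩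
    · rw [eq_comm, inv_eq_iff_mul_eq_one, ← map_mul, ClassGroup.mk0_eq_one_iff]
      rw [Submonoid.coe_mul, ← hJ']
      exact ⟨⟨_, rfl⟩⟩
    · rw [← Ideal.dvd_span_singleton, hJ']
      exact dvd_mul_left _ _

theorem exists_generator_of_pow_mem {v : HeightOneSpectrum (𝓞 F)} (hv : (ℓ : 𝓞 F) ∉ v.asIdeal)
    {N : ℕ} (hN : ClassGroup.mk0 ⟨v.asIdeal, mem_nonZeroDivisors_of_ne_zero v.ne_bot⟩ ^ N ∈
      primesAbove ℓ F) :
    ∃ y : F, y ≠ 0 ∧ v.valuation F y = exp (-N : ℤ) ∧ ∀ w : HeightOneSpectrum (𝓞 F),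
      (ℓ : 𝓞 F) ∉ w.asIdeal → w ≠ v → w.valuation F y = 1 := by
  -- Here `J` represents the inverse class of `v^N`, so `v^N J = (y)`, and `J` is invisible at
  -- places away from `ℓ`.
  obtain ⟨J, k, hJ, hk⟩ := exists_ideal_of_mem_primesAbove ((primesAbove ℓ F).inv_mem hN)
  rw [eq_comm, inv_eq_iff_mul_eq_one, ← map_pow, ← map_mul, ClassGroup.mk0_eq_one_iff] at hJ
  obtain ⟨y, hy⟩ := hJ
  change v.asIdeal ^ N * (J : Ideal (𝓞 F)) = Ideal.span {y} at hy
  have hnot : ∀ w : HeightOneSpectrum (𝓞 F), (ℓ : 𝓞 F) ∉ w.asIdeal →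
      ¬ (J : Ideal (𝓞 F)) ≤ w.asIdeal := fun w hw h => hw (w.isPrime.mem_of_pow_mem k (h hk))
  have hvN : v.asIdeal ^ N ≠ 0 := pow_ne_zero _ v.ne_bot
  have hy0 : y ≠ 0 := by
    rintro rfl
    rw [Ideal.span_singleton_eq_bot.2 rfl] at hy
    exact mul_ne_zero hvN (nonZeroDivisors.coe_ne_zero J) hy
  refine ⟨y, RingOfIntegers.coe_ne_zero_iff.2 hy0, ?_, ?_⟩
  · have h1 : v.intValuation y ≤ exp (-N : ℤ) := by
      rw [v.intValuation_le_pow_iff_mem, ← Ideal.dvd_span_singleton, ← hy]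
      exact dvd_mul_right _ _
    have h2 : ¬ v.intValuation y ≤ exp (-(N + 1 : ℕ) : ℤ) := by
      rw [v.intValuation_le_pow_iff_mem, ← Ideal.dvd_span_singleton, ← hy, pow_succ]
      intro h
      exact hnot v hv (Ideal.dvd_iff_le.1 ((mul_dvd_mul_iff_left hvN).1 h))
    rw [v.valuation_of_algebraMap]
    have h0 := v.intValuation_ne_zero y hy0
    rw [← exp_log h0, exp_le_exp] at h1 h2
    rw [← exp_log h0]
    congr 1
    push_cast at h2
    omega
  · intro w hw hwv
    rw [w.valuation_of_algebraMap, w.intValuation_eq_one_iff]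
    intro h
    rw [← Ideal.dvd_span_singleton, ← hy, Ideal.dvd_iff_le] at h
    rcases w.isPrime.mul_le.1 h with h | h
    · exact hwv (HeightOneSpectrum.ext (v.isMaximal.eq_of_le w.isPrime.ne_top (w.isPrime.le_of_pow_le h)).symm)
    · exact hnot w hw h

/-- Take `h` to be the prime-to-`ℓ` part of the order of the quotient: an `h`-th power falls in the
`ℓ`-part, where `ℓ^m` kills. -/
theorem exists_coprime_pow_mem {m : ℕ}
    (hm : Monoid.exponent ↥(ellIdealClasses ℓ F) = ℓ ^ m) :
    ∃ h : ℕ, h.Coprime ℓ ∧ ∀ c : ClassGroup (𝓞 F), c ^ (h * ℓ ^ m) ∈ primesAbove ℓ F := by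
  have hl : ℓ.Prime := Fact.out
  set Q := ClassGroup (𝓞 F) ⧸ primesAbove ℓ F
  have hQ : Nat.card Q ≠ 0 := Nat.card_pos.ne'
  obtain ⟨k, h, hnd, hcard⟩ := Nat.exists_eq_pow_mul_and_not_dvd hQ ℓ hl.ne_one
  refine ⟨h, ((Nat.Prime.coprime_iff_not_dvd hl).2 hnd).symm, fun c => ?_⟩
  have h1 : (QuotientGroup.mk c : Q) ^ h ∈ ellIdealClasses ℓ F := by
    refine ⟨k, ?_⟩
    rw [← pow_mul, mul_comm, ← hcard]
    exact pow_card_eq_one'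
  have h2 := Monoid.pow_exponent_eq_one (⟨_, h1⟩ : ↥(ellIdealClasses ℓ F))
  rw [hm] at h2
  have h3 := congrArg Subtype.val h2
  simp only [SubmonoidClass.coe_pow, OneMemClass.coe_one] at h3
  rw [← pow_mul, ← QuotientGroup.mk_pow, QuotientGroup.eq_one_iff] at h3
  exact h3

end ClassGroup

/-! ### Principal divisors prescribed away from `ℓ` -/

section Main

variable {F : Type*} [Field F] [NumberField F] {ℓ : ℕ} [Fact ℓ.Prime]

/-- Away from `ℓ` every value is an integer multiple of one constant, so the value module lies in a
cyclic one. -/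
theorem exists_eq_mul_of_mem_logValueModule {v : HeightOneSpectrum (𝓞 F)}
    (hv : (ℓ : 𝓞 F) ∉ v.asIdeal) {x : ℚ_[ℓ]} (hx : x ∈ logValueModule ℓ v) :
    ∃ c : ℤ_[ℓ], x = c * (-iwasawaLog ℓ (Ideal.absNorm v.asIdeal : ℚ_[ℓ]) / deg ℓ v) := by
  have h : logValueModule ℓ v ≤
      ℤ_[ℓ] ∙ (-iwasawaLog ℓ (Ideal.absNorm v.asIdeal : ℚ_[ℓ]) / deg ℓ v) := by
    refine Submodule.span_le.2 ?_
    rintro _ ⟨y, rfl⟩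
    refine Submodule.mem_span_singleton.2 ⟨(WithZero.log (Valued.v (y : v.adicCompletion F)) : ℤ), ?_⟩
    simp only [logVal_of_notMem hv]
    rw [Algebra.smul_def, map_intCast]
  obtain ⟨c, hc⟩ := Submodule.mem_span_singleton.1 (h hx)
  exact ⟨c, hc.symm⟩

/-- Away from `ℓ`, the `ℓ ^ m`-th multiple of a logarithmic divisor is principal. -/
theorem exists_principal_eq_away {m : ℕ}
    (hm : Monoid.exponent ↥(ellIdealClasses ℓ F) = ℓ ^ m) {D : RatDiv ℓ F} (hD : D ∈ logDiv ℓ F) :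
    ∃ E ∈ logPrincipal ℓ F, ∀ w : HeightOneSpectrum (𝓞 F), (ℓ : 𝓞 F) ∉ w.asIdeal →
      E w = (ℓ ^ m • D) w := by
  classical
  have hl : ℓ.Prime := Fact.out
  obtain ⟨h, hcop, hpow⟩ := exists_coprime_pow_mem hm
  have hu : IsUnit (h : ℤ_[ℓ]) := by
    rw [PadicInt.isUnit_iff]
    simpa using (PadicInt.norm_intCast_eq_one_iff (p := ℓ) (z := h)).2
      (Nat.isCoprime_iff_coprime.2 hcop)
  obtain ⟨u, hu⟩ := hu
  have key : ∀ v : HeightOneSpectrum (𝓞 F), (ℓ : 𝓞 F) ∉ v.asIdeal →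
      ∃ E ∈ logPrincipal ℓ F, E v = (ℓ ^ m • D) v ∧
        ∀ w : HeightOneSpectrum (𝓞 F), (ℓ : 𝓞 F) ∉ w.asIdeal → w ≠ v → E w = 0 := by
    intro v hv
    obtain ⟨y, hy0, hyv, hyw⟩ := exists_generator_of_pow_mem hv
      (hpow (ClassGroup.mk0 ⟨v.asIdeal, mem_nonZeroDivisors_of_ne_zero v.ne_bot⟩))
    obtain ⟨E, hE⟩ := exists_principal ℓ hy0
    obtain ⟨c, hc⟩ := exists_eq_mul_of_mem_logValueModule hv (hD v)
    -- At `v` the divisor of `y` has coefficient `-h ℓ^m` times the constant, and `D v` is `c` times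
    -- it; the factor `-c / h` matches `ℓ^m D v`.
    refine ⟨(-c * (u⁻¹ : ℤ_[ℓ]ˣ)) • E, Submodule.smul_mem _ _
      (Submodule.subset_span ⟨Units.mk0 y hy0, hE⟩), ?_, fun w hw hwv => ?_⟩
    · have hu1 : ((u⁻¹ : ℤ_[ℓ]ˣ) : ℤ_[ℓ]) * (h : ℤ_[ℓ]) = 1 := by rw [← hu, Units.inv_mul]
      have hu2 := congrArg (Subtype.val) hu1
      rw [PadicInt.coe_mul, PadicInt.coe_natCast, PadicInt.coe_one] at hu2
      rw [DirectSum.smul_apply, DirectSum.smul_apply, hE, logVal_of_notMem hv, valued_embedding, hyv, log_exp, hc,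
        Algebra.smul_def, nsmul_eq_mul]
      change ((-c * (u⁻¹ : ℤ_[ℓ]ˣ) : ℤ_[ℓ]) : ℚ_[ℓ]) * _ = _
      rw [PadicInt.coe_mul, PadicInt.coe_neg]
      push_cast
      linear_combination ((c : ℚ_[ℓ]) * (ℓ : ℚ_[ℓ]) ^ m *
        (-iwasawaLog ℓ (Ideal.absNorm v.asIdeal : ℚ_[ℓ]) / deg ℓ v)) * hu2
    · rw [DirectSum.smul_apply, hE, logVal_of_notMem hw, valued_embedding, hyw w hw hwv, log_one,
        Int.cast_zero, zero_mul, smul_zero]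
  choose! E hEp hEv hEw using key
  set T := (DFinsupp.support D).filter fun v => (ℓ : 𝓞 F) ∉ v.asIdeal with hT
  refine ⟨∑ v ∈ T, E v, Submodule.sum_mem _ fun v hv => hEp v (Finset.mem_filter.1 hv).2,
    fun w hw => ?_⟩
  rw [DFinsupp.finsetSum_apply]
  by_cases hwT : w ∈ T
  · rw [Finset.sum_eq_single_of_mem w hwT fun v hv hvw =>
      hEw v (Finset.mem_filter.1 hv).2 w hw hvw.symm]
    exact hEv w hw
  · have hDw : D w = 0 := by
      by_contra hne
      exact hwT (Finset.mem_filter.2 ⟨DFinsupp.mem_support_iff.2 hne, hw⟩)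
    rw [DirectSum.smul_apply, hDw, smul_zero]
    refine Finset.sum_eq_zero fun v hv => hEw v (Finset.mem_filter.1 hv).2 w hw ?_
    rintro rfl
    exact hwT hv

end Main

end LogClass

theorem mainTheorem7 (F : Type*) [Field F] [NumberField F] (ℓ : ℕ) [Fact ℓ.Prime]
    (m' mt : ℕ)
    (hm' : Monoid.exponent ↥(LogClass.ellIdealClasses ℓ F) = ℓ ^ m')
    (hmt : AddMonoid.exponent ↥(LogClass.logClassAbove ℓ F) = ℓ ^ mt) :
    (∀ D ∈ LogClass.logDivZero ℓ F, ℓ ^ (m' + mt) • D ∈ LogClass.logPrincipal ℓ F) ∧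
      AddMonoid.exponent (LogClass.LogClassGroup ℓ F) ∣ ℓ ^ (m' + mt) := by
  have key : ∀ D ∈ LogClass.logDivZero ℓ F, ℓ ^ (m' + mt) • D ∈ LogClass.logPrincipal ℓ F := by
    intro D hD
    obtain ⟨E, hE, hEw⟩ := LogClass.exists_principal_eq_away hm' hD.1
    have hD' : ℓ ^ m' • D - E ∈ LogClass.logDivZero ℓ F :=
      Submodule.sub_mem _ (nsmul_mem hD _) (LogClass.logPrincipal_le_logDivZero hE)
    have hab : (⟨_, hD'⟩ : ↥(LogClass.logDivZero ℓ F)) ∈ LogClass.logDivZeroAbove ℓ F := by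
      intro w hw
      change (ℓ ^ m' • D - E) w = 0
      rw [DirectSum.sub_apply, hEw w hw, sub_self]
    have h1 := AddMonoid.exponent_nsmul_eq_zero
      (⟨_, Submodule.mem_map_of_mem hab⟩ : ↥(LogClass.logClassAbove ℓ F))
    rw [hmt] at h1
    have h2 := congrArg Subtype.val h1
    change ℓ ^ mt • ((LogClass.logPrincipal ℓ F).submoduleOf (LogClass.logDivZero ℓ F)).mkQ
      ⟨_, hD'⟩ = 0 at h2
    rw [← map_nsmul, Submodule.mkQ_apply, Submodule.Quotient.mk_eq_zero] at h2
    have h3 : ℓ ^ mt • (ℓ ^ m' • D - E) ∈ LogClass.logPrincipal ℓ F := h2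
    -- Adding back `ℓ^mt E`, which is principal, recovers `ℓ^(m'+mt) D`.
    have h4 := Submodule.add_mem _ h3 (nsmul_mem hE (ℓ ^ mt))
    rwa [← smul_add, sub_add_cancel, smul_smul, ← pow_add, add_comm mt m'] at h4
  refine ⟨key, AddMonoid.exponent_dvd_of_forall_nsmul_eq_zero fun x => ?_⟩
  obtain ⟨D, rfl⟩ := Submodule.Quotient.mk_surjective _ x
  rw [← Submodule.Quotient.mk_smul, Submodule.Quotient.mk_eq_zero]
  exact key D.1 D.2
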